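/- A game arena $G=(P,V,(V_p)_{p\in P},v_0,\Delta)$ consists of finite sets $P$ of players and $V$ of vertices, a partition $(V_p)_{p\in P}$ of $V$, an initial vertex $v_0\in V$, and edges $\Delta\subseteq V\times V$ such that every vertex has an outgoing edge; its size is $|G|=|P|+|V|+|\Delta|$. A play is an infinite path from $v_0$. A positional strategy of $p$ is a map $s_p:V_p\to V$ with $(v,s_p(v))\in\Delta$ for all $v\in V_p$; $\mathrm{Pos}$ is the set of profiles $\boldsymbol s=(s_p)_{p\in P}$ of positional strategies, and $\mathrm{out}(\boldsymbol s)$ is the play that $\boldsymbol s$ generates. The Muller objective of a Boolean formula $\varphi$ over the variables $V$ is the set of plays $\rho$ such that $\varphi$ is true when exactly the vertices visited infinitely often by $\rho$ are set to true. An objective profile $\boldsymbol\alpha=(O_p)_{p\in P}$ assigns to each player a Muller objective, given by a formula; $p$ wins under $\boldsymbol s$ if $\mathrm{out}(\boldsymbol s)\in O_p$. An epistemic model $M=(W,(R_p)_{p\in P},(\sigma_p)_{p\in P})$ for $G$ consists of a finite set $W$ of worlds, equivalence relations $R_p$ on $W$, and maps $\sigma_p$ from $W$ to the positional strategies of $p$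 with $\sigma_p(w)=\sigma_p(w')$ whenever $(w,w')\in R_p$; write $\boldsymbol\sigma(w)=(\sigma_p(w))_{p\in P}$. Its size is $|W|+\sum_{p}|R_p|+|W|\cdot|V|$. Player $p$ is rational in $w$ if there is no positional strategy $s_p$ of $p$ such that (i) for every $w'$ with $(w,w')\in R_p$, if $p$ wins under $\boldsymbol\sigma(w')$ then $p$ wins under $\boldsymbol\sigma(w')[p\mapsto s_p]$, and (ii) for some $w'$ with $(w,w')\in R_p$, $p$ loses under $\boldsymbol\sigma(w')$ and wins under $\boldsymbol\sigma(w')[p\mapsto s_p]$. Let $\mathrm{RAT}\subseteq W$ be the set of worlds in which every player is rational. For $E\subseteq W$ let $\mathcal{MK}(E)=\bigcap_{p}\{w\mid R_p(w)\subseteq E\}$ and $\mathcal{CK}(E)=\bigcap_{i\ge1}\mathcal{MK}^i(E)$. For a polynomial $b$ with coefficients in $\mathbb N$, let $T_{b,G,\boldsymbol\alpha}$ be the set of all $\boldsymbol s\in\mathrm{Pos}$ for which there are an epistemic model $M$ for $G$ of size at most $b(|G|)$ and a world $w$ of $M$ with $w\in\mathcal{CK}(\mathrm{RAT})$ and $\boldsymbol\sigma(w)=\boldsymbol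 s$. Let $\mathrm{VPCKR}_{b,\mathrm{Pos}}$ be the problem: given $\langle G,\boldsymbol\alpha,O\rangle$, where $O$ is a Muller objective given by a formula, does $\mathrm{out}(\boldsymbol t)\in O$ hold for every $\boldsymbol t\in T_{b,G,\boldsymbol\alpha}$? Instances are encoded as binary words in a standard way (arena by its list of owners, initial vertex and adjacency matrix; formulas in prefix notation; indices in unary). **Theorem.** For every polynomial $b$, the problem $\mathrm{VPCKR}_{b,\mathrm{Pos}}$ is in $\Pi_2$ $(=\mathrm{coNP}^{\mathrm{NP}})$, the second level of the polynomial hierarchy. That is, for the language $L\subseteq\{0,1\}^*$ of the encodings of its yes-instances there are a polynomial $q$ and a relation $f$ decidable in deterministic polynomial time by a Turing machine such that, for all words $x$, $x\in L$ iff for every word $u$ with $|u|\le q(|x|)$ there is a word $v$ with $|v|\le q(|x|)$ and $f(x,u,v)$. -/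

import Mathlib

/-! ### Complexity: the class `Π₂` of the polynomial hierarchy, over Turing machines -/

namespace Complexity

/-- The input word `x # u # v` presented to a verifier. -/
def encodeTriple (t : List Bool × List Bool × List Bool) : List (Option Bool) :=
  t.1.map some ++ none :: (t.2.1.map some ++ none :: t.2.2.map some)

/-- The Boolean function `f` of three words is computable by a deterministic Turing machine whose
number of steps is bounded by a polynomial in the length of its input. -/
def PolyTime (f : List Bool × List Bool × List Bool → Bool) : Prop :=
  Nonempty (Turing.TM2ComputableInPolyTime encodeTriple Computability.encodeBool f)

/-- The class `Π₂` (`= coNP^NP`): `x ∈ L` iff for every `u` of polynomially bounded length there is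
a `v` of polynomially bounded length such that a polynomial-time verifier accepts `(x, u, v)`. -/
def InPi2 (L : Set (List Bool)) : Prop :=
  ∃ (f : List Bool × List Bool × List Bool → Bool) (q : Polynomial ℕ), PolyTime f ∧
    ∀ x : List Bool, x ∈ L ↔
      ∀ u : List Bool, u.length ≤ q.eval x.length →
        ∃ v : List Bool, v.length ≤ q.eval x.length ∧ f (x, u, v) = true

end Complexity

/-! ### Boolean formulas -/

/-- Boolean formulas with variables in `V`. -/
inductive BoolFormula (V : Type) : Type
  | tru : BoolFormula V
  | fls : BoolFormula V
  | var : V → BoolFormula V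
  | neg : BoolFormula V → BoolFormula V
  | and : BoolFormula V → BoolFormula V → BoolFormula V
  | or : BoolFormula V → BoolFormula V → BoolFormula V

/-- Truth of a formula under the assignment `θ`. -/
def BoolFormula.Holds {V : Type} (θ : V → Prop) : BoolFormula V → Prop
  | .tru => True
  | .fls => False
  | .var v => θ v
  | .neg φ => ¬ φ.Holds θ
  | .and φ ψ => φ.Holds θ ∧ ψ.Holds θ
  | .or φ ψ => φ.Holds θ ∨ ψ.Holds θ

/-! ### Graph games -/

/-- A game arena with players `P` and vertices `V`; the vertices controlled by `p` are those `v`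
with `owner v = p`, so that they form a partition of `V` indexed by `P`. -/
structure GameArena (P V : Type) where
  owner : V → P
  init : V
  edges : Finset (V × V)
  total : ∀ v, ∃ w, (v, w) ∈ edges

namespace GameArena

variable {P V : Type} (G : GameArena P V)

/-- The size of an arena: players, vertices and edges. -/
def size [Fintype P] [Fintype V] : ℕ :=
  Fintype.card P + Fintype.card V + G.edges.card

/-- The plays: infinite paths from the initial vertex. -/
def plays : Set (ℕ → V) :=
  {ρ | ρ 0 = G.init ∧ ∀ i, (ρ i, ρ (i + 1)) ∈ G.edges}

/-- The vertices visited infinitely often. -/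
def inf (ρ : ℕ → V) : Set V :=
  {v | ∀ i, ∃ j, i ≤ j ∧ ρ j = v}

/-- The Muller objective given by a Boolean formula over the vertices. -/
def muller (φ : BoolFormula V) : Set (ℕ → V) :=
  {ρ | ρ ∈ G.plays ∧ φ.Holds (fun v => v ∈ inf ρ)}

/-- The positional strategies of `p`: a choice of an outgoing edge at each vertex of `p`. -/
def PosStrategy (p : P) : Type :=
  {s : {v : V // G.owner v = p} → V // ∀ v, (v.1, s v) ∈ G.edges}

/-- The strategy profiles over positional strategies. -/
def PosProfile : Type := (p : P) → G.PosStrategy p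

/-- The outcome of a strategy profile. -/
def outcome (s : G.PosProfile) : ℕ → V
  | 0 => G.init
  | i + 1 => (s (G.owner (outcome s i))).1 ⟨outcome s i, rfl⟩

theorem outcome_mem_plays (s : G.PosProfile) : G.outcome s ∈ G.plays :=
  ⟨rfl, fun i => (s (G.owner (G.outcome s i))).2 ⟨G.outcome s i, rfl⟩⟩

/-- `s[p ↦ t]`. -/
def deviate [DecidableEq P] (s : G.PosProfile) (p : P) (t : G.PosStrategy p) : G.PosProfile :=
  Function.update s p t

/-- The set of winners for the objective profile `α` under `s`. -/
def win (α : P → Set (ℕ → V)) (s : G.PosProfile) : Set P :=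
  {p | G.outcome s ∈ α p}

end GameArena

/-! ### Epistemic models -/

/-- A KT5 Kripke frame with players `P` and worlds `W`. -/
structure KripkeFrame (P W : Type) where
  rel : P → W → W → Prop
  equiv : ∀ p, Equivalence (rel p)

namespace KripkeFrame

variable {P W : Type} (F : KripkeFrame P W)

/-- The event that `p` knows `E`. -/
def knows (p : P) (E : Set W) : Set W := {w | ∀ w', F.rel p w w' → w' ∈ E}

/-- The event that `E` is mutual knowledge. -/
def mutualKnowledge (E : Set W) : Set W := ⋂ p, F.knows p E

/-- The event that `E` is common knowledge. -/
def commonKnowledge (E : Set W) : Set W :=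
  ⋂ (i : ℕ) (_ : 1 ≤ i), F.mutualKnowledge^[i] E

end KripkeFrame

/-- An epistemic model with worlds `W` for the arena `G` and positional strategies. -/
structure EpistemicModel {P V : Type} (G : GameArena P V) (W : Type)
    extends KripkeFrame P W where
  strat : (p : P) → W → G.PosStrategy p
  strat_eq : ∀ p w w', rel p w w' → strat p w = strat p w'

namespace EpistemicModel

variable {P V W : Type} {G : GameArena P V} (M : EpistemicModel G W)

/-- The strategy profile `σ(w)`. -/
def profile (w : W) : G.PosProfile := fun p => M.strat p w

/-- The size of a model: the number of worlds, the number of pairs in the relations `R_p`, and the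
number of entries in the tables of all the profiles `σ(w)`, each of which has one entry per
vertex. -/
noncomputable def size [Fintype P] : ℕ :=
  Nat.card W + ∑ p : P, Nat.card {e : W × W // M.rel p e.1 e.2} + Nat.card W * Nat.card V

/-- The worlds in which player `p` is rational. -/
def rationalFor [DecidableEq P] (α : P → Set (ℕ → V)) (p : P) : Set W :=
  {w | ¬ ∃ t : G.PosStrategy p,
      (∀ w', M.rel p w w' → p ∈ G.win α (M.profile w') →
        p ∈ G.win α (G.deviate (M.profile w') p t)) ∧
      (∃ w', M.rel p w w' ∧ p ∉ G.win α (M.profile w') ∧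
        p ∈ G.win α (G.deviate (M.profile w') p t))}

/-- The worlds in which every player is rational. -/
def rational [DecidableEq P] (α : P → Set (ℕ → V)) : Set W := ⋂ p, M.rationalFor α p

end EpistemicModel

/-- The positional profiles that can be realized under common knowledge of rationality in a finite
epistemic model of size at most `b (size of G)`. -/
def GameArena.ckrProfiles {P V : Type} [Fintype P] [Fintype V] [DecidableEq P]
    (b : Polynomial ℕ) (G : GameArena P V) (α : P → Set (ℕ → V)) : Set G.PosProfile :=
  {s | ∃ (W : Type) (_ : Finite W) (M : EpistemicModel G W),
      M.size ≤ b.eval G.size ∧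
      ∃ w : W, w ∈ M.commonKnowledge (M.rational α) ∧ M.profile w = s}

/-! ### The verification problem -/

/-- An instance `⟨G, α, O⟩`, with numbered players and vertices; the objectives and the
specification are Muller objectives, given by formulas. -/
structure CKRInstance where
  numPlayers : ℕ
  numVertices : ℕ
  arena : GameArena (Fin numPlayers) (Fin numVertices)
  objective : Fin numPlayers → BoolFormula (Fin numVertices)
  spec : BoolFormula (Fin numVertices)

/-- The yes-instances of the verification problem with common knowledge of rationality, for
positional strategies and models whose size is at most `b` of the size of the arena. -/
def VPCKR (b : Polynomial ℕ) : Set CKRInstance :=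
  {I | ∀ t ∈ I.arena.ckrProfiles b (fun p => I.arena.muller (I.objective p)),
      I.arena.outcome t ∈ I.arena.muller I.spec}

/-! ### Encoding of instances by binary words -/

/-- `1ᵏ0`. -/
def encodeIndex (k : ℕ) : List Bool := List.replicate k true ++ [false]

/-- Formulas are written in prefix notation. -/
def BoolFormula.encode {n : ℕ} : BoolFormula (Fin n) → List Bool
  | .tru => [false, false, false]
  | .fls => [false, false, true]
  | .var v => [false, true] ++ encodeIndex v
  | .neg φ => [true, false] ++ φ.encode
  | .and φ ψ => [true, true, false] ++ φ.encode ++ ψ.encode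
  | .or φ ψ => [true, true, true] ++ φ.encode ++ ψ.encode

/-- The number of players, the number of vertices, the owner of each vertex, the initial vertex,
the adjacency matrix, the objectives of the players, the specification. -/
def CKRInstance.encode (I : CKRInstance) : List Bool :=
  encodeIndex I.numPlayers ++ encodeIndex I.numVertices ++
  (List.finRange I.numVertices).flatMap (fun v => encodeIndex (I.arena.owner v)) ++
  encodeIndex I.arena.init ++
  (List.finRange I.numVertices).flatMap (fun v =>
    (List.finRange I.numVertices).map (fun w => decide ((v, w) ∈ I.arena.edges))) ++
  (List.finRange I.numPlayers).flatMap (fun p => (I.objective p).encode) ++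
  I.spec.encode

/-- The verification problem as a language of binary words. -/
def VPCKRLanguage (b : Polynomial ℕ) : Set (List Bool) :=
  CKRInstance.encode '' VPCKR b

/-! ### Structured stack programs and their implementation by Turing machines -/

namespace Complexity

open Function

/-! That a player is not rational in a world has a short witness: one positional deviation. Once
common knowledge of rationality is replaced by rationality in all worlds, a yes-instance is one
where every model of bounded size either contains a witness of irrationality or satisfies the
specification in all worlds, which is a Π₂ condition. The replacement (`mem_VPCKR_iff`) works
because the set of worlds where rationality is commonly known is closed under all relations:
restricting the model to it keeps every information cell, hence rationality, and does not increase
the size.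

The words `u` and `v` carry tables of numbers written in unary. Every `u` is read as a candidate
model, and no certificate is demanded if it fails `ValidModel`. The word `v` holds a parse of `x`
and a certificate for `u`: a player, a world and a deviation, the outcomes in all worlds with and
without the deviation, and the truth values of all formulas under these outcomes. Every condition on
these tables is local. Two facts allow this. Under a positional profile the current vertex
determines the rest of the play, so the vertices visited infinitely often are those visited between
the times |V| and 2|V| (`GameArena.mem_inf_outcome`). And a formula in prefix notation is evaluated
by rules that relate a position only to the positions of its immediate subformulas
(`TruthTable.holds_iff`). Since the encoding is injective (`encode_injective`), no `v` can
substitute another instance. Completeness is `Describes.exists_accepts`, soundness `Accepts.sound`.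

It remains to run the verifier in polynomial time. It is built from bounded quantifiers, arithmetic
and bit tests, so its indicator is the value of a fixed expression with bounded sums, truncated
subtraction and bit lookup. The values of such an expression are polynomially bounded
(`Expr.val_le`), so evaluation by nested loops over unary counters takes polynomial time
(`Expr.run_compile`), and a stack machine carries out such programs (`Cmd.Run.reachesIn`). The
classes `Wd`, `Tm` and `Df` turn definability of the verifier into instance search. -/

/-- Structured programs over Boolean stacks numbered by `ℕ`. The commands `case` and `loop` pop the
symbol that they test. -/
inductive Cmd : Type
  | skip : Cmd
  | push : ℕ → Bool → Cmd
  | seq : Cmd → Cmd → Cmd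
  | case : ℕ → Cmd → Cmd → Cmd → Cmd
  | loop : ℕ → Cmd → Cmd → Cmd

/-- The contents of all stacks. -/
abbrev Store : Type := ℕ → List Bool

namespace Cmd

/-- `Run c S S' n`: the program `c` leads from `S` to `S'` in at most `n` steps. -/
inductive Run : Cmd → Store → Store → ℕ → Prop
  | skip (S : Store) : Run skip S S 1
  | push (S : Store) (k : ℕ) (b : Bool) : Run (push k b) S (update S k (b :: S k)) 1
  | seq {c d : Cmd} {S S' S'' : Store} {m n : ℕ} :
      Run c S S' m → Run d S' S'' n → Run (seq c d) S S'' (m + n)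
  | case_nil {k : ℕ} {e c d : Cmd} {S S' : Store} {n : ℕ} :
      S k = [] → Run e S S' n → Run (case k e c d) S S' (n + 1)
  | case_cons {k : ℕ} {e c d : Cmd} {S S' : Store} {n : ℕ} {b : Bool} {t : List Bool} :
      S k = b :: t → Run (cond b d c) (update S k t) S' n → Run (case k e c d) S S' (n + 1)
  | loop_nil {k : ℕ} {c d : Cmd} {S : Store} : S k = [] → Run (loop k c d) S S 1
  | loop_cons {k : ℕ} {c d : Cmd} {S S' S'' : Store} {m n : ℕ} {b : Bool} {t : List Bool} :
      S k = b :: t → Run (cond b d c) (update S k t) S' m → Run (loop k c d) S' S'' n →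
        Run (loop k c d) S S'' (m + n + 1)
  | mono {c : Cmd} {S S' : Store} {m n : ℕ} : Run c S S' m → m ≤ n → Run c S S' n

/-- The number of stacks used by a program. -/
def width : Cmd → ℕ
  | skip => 0
  | push k _ => k
  | seq c d => max c.width d.width
  | case k e c d => max k (max e.width (max c.width d.width))
  | loop k c d => max k (max c.width d.width)

/-- The program points. -/
def Label : Cmd → Type
  | skip => Unit
  | push _ _ => Unit
  | seq c d => c.Label ⊕ d.Label
  | case _ e c d => Option (e.Label ⊕ (c.Label ⊕ d.Label))
  | loop _ c d => Option (c.Label ⊕ d.Label)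

theorem finite_label : ∀ c : Cmd, Finite c.Label
  | skip => inferInstanceAs (Finite Unit)
  | push _ _ => inferInstanceAs (Finite Unit)
  | seq c d =>
    have := c.finite_label
    have := d.finite_label
    inferInstanceAs (Finite (c.Label ⊕ d.Label))
  | case _ e c d =>
    have := e.finite_label
    have := c.finite_label
    have := d.finite_label
    inferInstanceAs (Finite (Option (e.Label ⊕ (c.Label ⊕ d.Label))))
  | loop _ c d =>
    have := c.finite_label
    have := d.finite_label
    inferInstanceAs (Finite (Option (c.Label ⊕ d.Label)))

/-- The program point at which the execution starts. -/
def entry : (c : Cmd) → c.Label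
  | skip => ()
  | push _ _ => ()
  | seq c _ => .inl c.entry
  | case _ _ _ _ => none
  | loop _ _ _ => none

end Cmd

/-- The alphabets of the input stack `none` and of the work stacks. -/
abbrev Alphabet {m : ℕ} : Option (Fin (m + 1)) → Type
  | none => Option Bool
  | some _ => Bool

/-- The work stack number `k`. -/
abbrev workStack (m k : ℕ) : Option (Fin (m + 1)) := some (Fin.ofNat (m + 1) k)

/-- The last symbol that was popped. -/
abbrev Popped : Type := Option (Option Bool)

/-- The stacks of a machine with input `l` on the input stack and `S` on the work stacks. -/
def machineStacks {m : ℕ} (l : List (Option Bool)) (S : Store) :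
    (k : Option (Fin (m + 1))) → List (Alphabet k)
  | none => l
  | some i => S i

/-- The machine reduces stack numbers modulo `m + 1`. The bound `k ≤ m` makes this reduction
trivial, so distinct stacks are not confused. -/
theorem update_machineStacks {m k : ℕ} (hk : k ≤ m) (l : List (Option Bool)) (S : Store)
    (t : List Bool) :
    update (machineStacks (m := m) l S) (workStack m k) t = machineStacks l (update S k t) := by
  have hk' : (Fin.ofNat (m + 1) k).val = k := Nat.mod_eq_of_lt (by omega)
  funext i
  rcases i with _ | i
  · rw [update_of_ne (by simp)]; rfl
  · by_cases h : i = Fin.ofNat (m + 1) k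
    · subst h
      rw [update_self]
      simp [machineStacks, Nat.mod_eq_of_lt (show k < m + 1 by omega)]
    · rw [update_of_ne (by simpa using h)]
      have : i.val ≠ k := fun h' => h (Fin.ext (by rw [hk', h']))
      simp [machineStacks, this]

theorem update_machineStacks_none {m : ℕ} (l l' : List (Option Bool)) (S : Store) :
    update (machineStacks (m := m) l S) none l' = machineStacks l' S := by
  funext i
  rcases i with _ | i
  · rw [update_self]; rfl
  · rw [update_of_ne (by simp)]; rfl

theorem machineStacks_workStack {m k : ℕ} (hk : k ≤ m) (l : List (Option Bool)) (S : Store) :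
    machineStacks (m := m) l S (workStack m k) = S k := by
  have hk' : (Fin.ofNat (m + 1) k).val = k := Nat.mod_eq_of_lt (by omega)
  simp [machineStacks, workStack, Nat.mod_eq_of_lt (show k < m + 1 by omega)]

/-! ### Translation of programs into machine statements, and its correctness. -/

namespace Cmd

/-- Pop a symbol from the work stack `k` and go to a label depending on it. -/
def popStmt {Λ : Type} (m k : ℕ) (f : Option Bool → Λ) :
    Turing.TM2.Stmt (Alphabet (m := m)) Λ Popped :=
  .pop (workStack m k) (fun _ o => Option.map some o) (.goto fun s => f (s.bind id))

/-- The statement of a program point, with `f` embedding the program points into the labels of a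
machine, and `ex` the label at which the execution continues. -/
def code {Λ : Type} (m : ℕ) :
    (c : Cmd) → (c.Label → Λ) → Λ → c.Label → Turing.TM2.Stmt (Alphabet (m := m)) Λ Popped
  | skip, _, ex, _ => .goto fun _ => ex
  | push k b, _, ex, _ => .push (workStack m k) (fun _ => b) (.goto fun _ => ex)
  | seq c d, f, _, .inl l => c.code m (fun l => f (.inl l)) (f (.inr d.entry)) l
  | seq _ d, f, ex, .inr l => d.code m (fun l => f (.inr l)) ex l
  | case k e c d, f, _, none => popStmt m k fun
      | none => f (some (.inl e.entry))
      | some false => f (some (.inr (.inl c.entry)))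
      | some true => f (some (.inr (.inr d.entry)))
  | case _ e _ _, f, ex, some (.inl l) => e.code m (fun l => f (some (.inl l))) ex l
  | case _ _ c _, f, ex, some (.inr (.inl l)) => c.code m (fun l => f (some (.inr (.inl l)))) ex l
  | case _ _ _ d, f, ex, some (.inr (.inr l)) => d.code m (fun l => f (some (.inr (.inr l)))) ex l
  | loop k c d, f, ex, none => popStmt m k fun
      | none => ex
      | some false => f (some (.inl c.entry))
      | some true => f (some (.inr d.entry))
  | loop _ c _, f, _, some (.inl l) => c.code m (fun l => f (some (.inl l))) (f none) l
  | loop _ _ d, f, _, some (.inr l) => d.code m (fun l => f (some (.inr l))) (f none) l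

end Cmd

/-- `ReachesIn P a b n`: the machine `P` leads from `a` to `b` in at most `n` steps. -/
def ReachesIn {m : ℕ} {Λ : Type} (P : Λ → Turing.TM2.Stmt (Alphabet (m := m)) Λ Popped)
    (a b : Turing.TM2.Cfg (Alphabet (m := m)) Λ Popped) (n : ℕ) : Prop :=
  ∃ j ≤ n, (flip bind (Turing.TM2.step P))^[j] (some a) = some b

namespace ReachesIn

variable {m : ℕ} {Λ : Type} {P : Λ → Turing.TM2.Stmt (Alphabet (m := m)) Λ Popped}
  {a b c : Turing.TM2.Cfg (Alphabet (m := m)) Λ Popped} {n n' : ℕ}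

theorem trans (h : ReachesIn P a b n) (h' : ReachesIn P b c n') : ReachesIn P a c (n + n') := by
  obtain ⟨j, hj, e⟩ := h
  obtain ⟨j', hj', e'⟩ := h'
  refine ⟨j' + j, by omega, ?_⟩
  rw [iterate_add_apply, e, e']

theorem mono (h : ReachesIn P a b n) (hn : n ≤ n') : ReachesIn P a b n' := by
  obtain ⟨j, hj, e⟩ := h
  exact ⟨j, hj.trans hn, e⟩

theorem step (h : Turing.TM2.step P a = some b) : ReachesIn P a b 1 :=
  ⟨1, le_rfl, by simpa [flip] using h⟩

end ReachesIn

theorem Cmd.step_popStmt {m : ℕ} {Λ : Type} {P : Λ → Turing.TM2.Stmt (Alphabet (m := m)) Λ Popped}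
    {k : ℕ} {g : Option Bool → Λ} {l : Λ} (hP : P l = popStmt m k g) (hk : k ≤ m)
    (S : Store) (v : Popped) :
    ∃ v', ReachesIn P ⟨some l, v, machineStacks [] S⟩
      ⟨some (g (S k).head?), v', machineStacks [] (update S k (S k).tail)⟩ 1 := by
  refine ⟨Option.map some (S k).head?, ReachesIn.step ?_⟩
  rw [Turing.TM2.step, hP, popStmt, ← update_machineStacks hk, ← machineStacks_workStack hk [] S]
  simp only [Turing.TM2.stepAux]
  cases (machineStacks (m := m) [] S (workStack m k)).head? <;> rfl

/-- The machine executes structured programs. -/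
theorem Cmd.Run.reachesIn {m : ℕ} {Λ : Type}
    {P : Λ → Turing.TM2.Stmt (Alphabet (m := m)) Λ Popped} {c : Cmd} {S S' : Store} {n : ℕ}
    (h : Run c S S' n) :
    c.width ≤ m → ∀ (f : c.Label → Λ) (ex : Λ), (∀ l, P (f l) = c.code m f ex l) → ∀ v,
      ∃ v', ReachesIn P ⟨some (f c.entry), v, machineStacks [] S⟩
        ⟨some ex, v', machineStacks [] S'⟩ n := by
  induction h with
  | skip S =>
    intro _ f ex hP v
    refine ⟨v, ReachesIn.step ?_⟩
    rw [Turing.TM2.step, hP, code]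
    rfl
  | push S k b =>
    intro hw f ex hP v
    refine ⟨v, ReachesIn.step ?_⟩
    have hk : k ≤ m := hw
    rw [Turing.TM2.step, hP, code, ← update_machineStacks hk, ← machineStacks_workStack hk [] S]
    rfl
  | @seq c d S S' S'' m n _ _ ihc ihd =>
    intro hw f ex hP v
    simp only [width, max_le_iff] at hw
    obtain ⟨v', h⟩ := ihc hw.1 (fun l => f (.inl l)) (f (.inr d.entry)) (fun l => hP (.inl l)) v
    obtain ⟨v'', h'⟩ := ihd hw.2 (fun l => f (.inr l)) ex (fun l => hP (.inr l)) v'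
    exact ⟨v'', h.trans h'⟩
  | @case_nil k e c d S S' n hk _ ih =>
    intro hw f ex hP v
    simp only [width, max_le_iff] at hw
    obtain ⟨v', h⟩ := step_popStmt (hP none) hw.1 S v
    obtain ⟨v'', h'⟩ := ih hw.2.1 (fun l => f (some (.inl l))) ex (fun l => hP (some (.inl l))) v'
    have hS : update S k (S k).tail = S := by rw [hk, List.tail_nil, ← hk, update_eq_self]
    rw [hS, hk] at h
    exact ⟨v'', (h.trans h').mono (by omega)⟩
  | @case_cons k e c d S S' n b t hk _ ih =>
    intro hw f ex hP v
    simp only [width, max_le_iff] at hw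
    obtain ⟨v', h⟩ := step_popStmt (hP none) hw.1 S v
    rw [hk] at h
    cases b
    · obtain ⟨v'', h'⟩ := ih hw.2.2.1 (fun l => f (some (.inr (.inl l)))) ex
        (fun l => hP (some (.inr (.inl l)))) v'
      exact ⟨v'', (h.trans h').mono (by omega)⟩
    · obtain ⟨v'', h'⟩ := ih hw.2.2.2 (fun l => f (some (.inr (.inr l)))) ex
        (fun l => hP (some (.inr (.inr l)))) v'
      exact ⟨v'', (h.trans h').mono (by omega)⟩
  | @loop_nil k c d S hk =>
    intro hw f ex hP v
    simp only [width, max_le_iff] at hw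
    obtain ⟨v', h⟩ := step_popStmt (hP none) hw.1 S v
    have hS : update S k (S k).tail = S := by rw [hk, List.tail_nil, ← hk, update_eq_self]
    rw [hS, hk] at h
    exact ⟨v', h⟩
  | @loop_cons k c d S S' S'' n₁ n₂ b t hk _ _ ih ih' =>
    intro hw f ex hP v
    have hw' := hw
    simp only [width, max_le_iff] at hw
    obtain ⟨v', h⟩ := step_popStmt (hP none) hw.1 S v
    rw [hk] at h
    cases b
    -- The body continues at `f none`, the test of the loop itself, where the run of the remaining
    -- iterations starts.
    · obtain ⟨v'', h'⟩ := ih hw.2.1 (fun l => f (some (.inl l))) (f none)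
        (fun l => hP (some (.inl l))) v'
      obtain ⟨v₃, h₃⟩ := ih' hw' f ex hP v''
      exact ⟨v₃, ((h.trans h').trans h₃).mono (by omega)⟩
    · obtain ⟨v'', h'⟩ := ih hw.2.2 (fun l => f (some (.inr l))) (f none)
        (fun l => hP (some (.inr l))) v'
      obtain ⟨v₃, h₃⟩ := ih' hw' f ex hP v''
      exact ⟨v₃, ((h.trans h').trans h₃).mono (by omega)⟩
  | mono _ hn ih =>
    intro hw f ex hP v
    obtain ⟨v', h⟩ := ih hw f ex hP v
    exact ⟨v', h.mono hn⟩

end Complexity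

namespace Complexity

open Function

/-! ### Machines that read a triple of words, run a program and output a bit -/

/-- The labels of the machine of a program: the three reading phases, the program points, and the
halting label. -/
abbrev TripleLabel (c : Cmd) : Type := Fin 3 ⊕ Option c.Label

/-- Read the input onto the stacks `0`, `1`, `2`, in reversed order, run the program and halt. -/
def tripleCode (m : ℕ) (c : Cmd) :
    TripleLabel c → Turing.TM2.Stmt (Alphabet (m := m)) (TripleLabel c) Popped
  | .inl i => .pop none (fun _ o => o)
      (.branch (fun s => (s.bind id).isSome)
        (.push (workStack m i) (fun s => (s.bind id).getD false) (.goto fun _ => .inl i))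
        (.goto fun s => if s.isSome then .inl (Fin.ofNat 3 (i + 1)) else .inr (some c.entry)))
  | .inr (some l) => c.code m (fun l => .inr (some l)) (.inr none) l
  | .inr none => .load (fun _ => none) .halt

/-- The machine of a program. -/
noncomputable def tripleMachine (m : ℕ) (c : Cmd) : Turing.FinTM2 where
  K := Option (Fin (m + 1))
  k₀ := none
  k₁ := workStack m 0
  Γ := Alphabet
  Λ := TripleLabel c
  main := .inl 0
  ΛFin := by
    have := c.finite_label
    exact Fintype.ofFinite _
  σ := Popped
  initialState := none
  Γk₀Fin := inferInstanceAs (Fintype (Option Bool))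
  m := tripleCode m c

/-- Popping, testing and pushing form a single statement, so each symbol costs one step. Moving from
stack to stack reverses the word. -/
theorem reachesIn_read {m : ℕ} (c : Cmd) (i : Fin 3) (hi : i.val ≤ m) (w : List Bool)
    (r : List (Option Bool)) (S : Store) (v : Popped) :
    ∃ v', ReachesIn (tripleCode m c) ⟨some (.inl i), v, machineStacks (w.map some ++ r) S⟩
      ⟨some (.inl i), v', machineStacks r (update S i (w.reverse ++ S i))⟩ w.length := by
  induction w generalizing S v with
  | nil => exact ⟨v, 0, le_rfl, by simp⟩
  | cons b w ih =>
    obtain ⟨v', h⟩ := ih (update S i (b :: S i)) (some (some b))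
    refine ⟨v', ReachesIn.mono (ReachesIn.trans (ReachesIn.step ?_) h) (n' := w.length + 1)
      (by simp [Nat.add_comm]) |> fun h => by simpa using h⟩
    rw [Turing.TM2.step, tripleCode, Turing.TM2.stepAux]
    change some (Turing.TM2.stepAux _ _ (update (machineStacks _ S) none (w.map some ++ r))) = _
    rw [update_machineStacks_none, ← update_machineStacks hi,
      ← machineStacks_workStack hi (w.map some ++ r) S]
    rfl

/-- A separator and an exhausted input both fail the bit test, but leave `some none` and `none` in
the register, which tells them apart. The phase number is taken modulo 3; with only two separators
in the input it never wraps around. -/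
theorem reachesIn_separator {m : ℕ} (c : Cmd) (i : Fin 3)
    (r : List (Option Bool)) (S : Store) (v : Popped) :
    ∃ v', ReachesIn (tripleCode m c) ⟨some (.inl i), v, machineStacks (none :: r) S⟩
      ⟨some (.inl (Fin.ofNat 3 (i + 1))), v', machineStacks r S⟩ 1 := by
  refine ⟨some none, ReachesIn.step ?_⟩
  rw [Turing.TM2.step, tripleCode, Turing.TM2.stepAux]
  change some (Turing.TM2.stepAux _ _ (update (machineStacks _ S) none r)) = _
  rw [update_machineStacks_none]
  rfl

theorem reachesIn_entry {m : ℕ} (c : Cmd) (i : Fin 3) (S : Store) (v : Popped) :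
    ∃ v', ReachesIn (tripleCode m c) ⟨some (.inl i), v, machineStacks [] S⟩
      ⟨some (.inr (some c.entry)), v', machineStacks [] S⟩ 1 := by
  refine ⟨none, ReachesIn.step ?_⟩
  rw [Turing.TM2.step, tripleCode, Turing.TM2.stepAux]
  change some (Turing.TM2.stepAux _ _ (update (machineStacks _ S) none [])) = _
  rw [update_machineStacks_none]
  rfl

/-- The stacks `0`, `1`, `2` hold three words. -/
def tripleStore (x u v : List Bool) : Store := fun k =>
  if k = 0 then x else if k = 1 then u else if k = 2 then v else []

/-- The program finds the three words reversed, as the reading phases leave them. It must clear all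
stacks except the output, because a halting configuration of the machine has no other contents. The
argument of `p` is the length of the encoded triple. -/
theorem polyTime_of_run {f : List Bool × List Bool × List Bool → Bool} {c : Cmd}
    (p : Polynomial ℕ)
    (h : ∀ x u v, c.Run (tripleStore x.reverse u.reverse v.reverse)
      (update (fun _ => []) 0 [f (x, u, v)]) (p.eval (x.length + u.length + v.length + 2))) :
    PolyTime f := by
  set m := max 2 c.width with hm
  have key : ∀ x u v, ReachesIn (tripleCode m c)
      ⟨some (.inl 0), none, machineStacks (encodeTriple (x, u, v)) (fun _ => [])⟩
      ⟨none, none, machineStacks [] (update (fun _ => []) 0 [f (x, u, v)])⟩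
      ((Polynomial.X + 3 + p).eval (encodeTriple (x, u, v)).length) := by
    intro x u v
    obtain ⟨v₁, h₁⟩ := reachesIn_read (m := m) c 0 (by simp) x
      (none :: (u.map some ++ none :: v.map some)) (fun _ => []) none
    obtain ⟨v₂, h₂⟩ := reachesIn_separator (m := m) c 0 (u.map some ++ none :: v.map some)
      (update (fun _ => []) 0 x.reverse) v₁
    obtain ⟨v₃, h₃⟩ := reachesIn_read (m := m) c 1 (by simp [hm]) u
      (none :: v.map some) (update (fun _ => []) 0 x.reverse) v₂
    obtain ⟨v₄, h₄⟩ := reachesIn_separator (m := m) c 1 (v.map some)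
      (update (update (fun _ => []) 0 x.reverse) 1 u.reverse) v₃
    obtain ⟨v₅, h₅⟩ := reachesIn_read (m := m) c 2 (by simp [hm]) v
      [] (update (update (fun _ => []) 0 x.reverse) 1 u.reverse) v₄
    obtain ⟨v₆, h₆⟩ := reachesIn_entry (m := m) c 2
      (update (update (update (fun _ => []) 0 x.reverse) 1 u.reverse) 2 v.reverse) v₅
    have hS : update (update (update (fun _ => []) 0 x.reverse) 1 u.reverse) 2 v.reverse
        = tripleStore x.reverse u.reverse v.reverse := by
      funext k
      rcases k with _ | _ | _ | k <;> simp [tripleStore]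
    obtain ⟨v₇, h₇⟩ := (h x u v).reachesIn (P := tripleCode m c) (le_max_right _ _)
      (fun l => .inr (some l)) (.inr none) (fun _ => rfl) v₆
    -- The last step resets the register, since the halting configuration requires its initial
    -- value.
    have h₈ : ReachesIn (tripleCode m c)
        ⟨some (.inr none), v₇, machineStacks [] (update (fun _ => []) 0 [f (x, u, v)])⟩
        ⟨none, none, machineStacks [] (update (fun _ => []) 0 [f (x, u, v)])⟩ 1 :=
      ReachesIn.step rfl
    simp only [List.append_nil, Fin.val_zero, Fin.val_one, Fin.val_two, ne_eq, one_ne_zero,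
      not_false_eq_true, update_of_ne, OfNat.ofNat_ne_zero, OfNat.ofNat_ne_one] at h₁ h₃ h₅
    rw [hS] at h₅ h₆
    refine ((h₁.trans h₂).trans ((h₃.trans h₄).trans (h₅.trans (h₆.trans (h₇.trans h₈))))).mono ?_
    have hl : (encodeTriple (x, u, v)).length = x.length + u.length + v.length + 2 := by
      simp [encodeTriple]; omega
    rw [hl]
    simp only [Polynomial.eval_add, Polynomial.eval_X, Polynomial.eval_ofNat]
    omega
  have e₁ : ∀ x u v, Turing.initList (tripleMachine m c)
      (List.map (Equiv.refl (Option Bool)).invFun (encodeTriple (x, u, v)))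
      = ⟨some (.inl 0), none, machineStacks (encodeTriple (x, u, v)) (fun _ => [])⟩ := by
    intro x u v
    unfold Turing.initList
    congr 1
    funext k
    rcases k with _ | k
    · simp [tripleMachine, machineStacks]
      rfl
    · simp [tripleMachine, machineStacks]
  have e₂ : ∀ x u v, Turing.haltList (tripleMachine m c)
      (List.map (Equiv.refl Bool).invFun (Computability.encodeBool (f (x, u, v))))
      = ⟨none, none, machineStacks [] (update (fun _ => []) 0 [f (x, u, v)])⟩ := by
    intro x u v
    unfold Turing.haltList
    congr 1
    funext k
    rcases k with _ | k
    · simp [tripleMachine, machineStacks]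
    · by_cases hk : k = 0
      · subst hk
        simp [tripleMachine, machineStacks, Computability.encodeBool]
        rfl
      · simp [tripleMachine, machineStacks, hk]
  refine ⟨⟨⟨tripleMachine m c, Equiv.refl (Option Bool), Equiv.refl Bool⟩,
    Polynomial.X + 3 + p, fun ⟨x, u, v⟩ => ⟨⟨(key x u v).choose, ?_⟩, (key x u v).choose_spec.1⟩⟩⟩
  exact (congrArg _ (congrArg some (e₁ x u v))).trans
    ((key x u v).choose_spec.2.trans (congrArg some (e₂ x u v).symm))

end Complexity

namespace Complexity

open Function

/-! ### Counting expressions -/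

/-- Prepend a value to a sequence. -/
def extend {α : Type} (a : α) (c : ℕ → α) : ℕ → α
  | 0 => a
  | i + 1 => c i

/-- Expressions for natural numbers, with words as variables. -/
inductive Expr : Type
  | length : ℕ → Expr
  | one : Expr
  | add : Expr → Expr → Expr
  | sub : Expr → Expr → Expr
  | bit : ℕ → Expr → Expr
  | sum : Expr → Expr → Expr

namespace Expr

/-- The value of an expression in a context; the index of a sum is a word of that length. -/
def val : Expr → Store → ℕ
  | length i, c => (c i).length
  | one, _ => 1
  | add s t, c => s.val c + t.val c
  | sub s t, c => s.val c - t.val c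
  | bit i t, c => if (c i)[t.val c]? = some true then 1 else 0
  | sum t s, c => ∑ n ∈ Finset.range (t.val c), s.val (extend (List.replicate n false) c)

/-- A bound for the value of an expression in terms of the lengths of the words of the context. -/
noncomputable def valBound : Expr → Polynomial ℕ
  | length _ => .X
  | one => 1
  | add s t => s.valBound + t.valBound
  | sub s _ => s.valBound
  | bit _ _ => 1
  | sum t s => t.valBound * s.valBound.comp (.X + t.valBound)

theorem _root_.Polynomial.eval_le_eval_of_le (p : Polynomial ℕ) {a b : ℕ} (h : a ≤ b) :
    p.eval a ≤ p.eval b := by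
  rw [Polynomial.eval_eq_sum, Polynomial.eval_eq_sum]
  exact Finset.sum_le_sum fun i _ => Nat.mul_le_mul_left _ (Nat.pow_le_pow_left h i)

theorem length_extend_le {c : Store} {m n : ℕ} (hc : ∀ i, (c i).length ≤ m) {k : ℕ} (hn : n ≤ k)
    (i : ℕ) : (extend (List.replicate n false) c i).length ≤ m + k := by
  rcases i with _ | i
  · simp [extend]; omega
  · exact (hc i).trans (Nat.le_add_right _ _)

/-- Below a sum the context gains an index word no longer than the bound for the range. This is the
reason for the composition in `valBound`. -/
theorem val_le (e : Expr) : ∀ {c : Store} {m : ℕ}, (∀ i, (c i).length ≤ m) →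
    e.val c ≤ e.valBound.eval m := by
  induction e with
  | length i => intro c m hc; simpa [val, valBound] using hc i
  | one => intro c m hc; simp [val, valBound]
  | add s t ihs iht => intro c m hc; simpa [val, valBound] using Nat.add_le_add (ihs hc) (iht hc)
  | sub s t ihs iht => intro c m hc; exact (Nat.sub_le _ _).trans (ihs hc)
  | bit i t iht => intro c m hc; simp only [val, valBound]; split <;> simp
  | sum t s iht ihs =>
    intro c m hc
    simp only [val, valBound, Polynomial.eval_mul, Polynomial.eval_comp, Polynomial.eval_add,
      Polynomial.eval_X]
    have h : ∀ n ∈ Finset.range (t.val c), s.val (extend (List.replicate n false) c)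
        ≤ s.valBound.eval (m + t.valBound.eval m) := fun n hn =>
      ihs (length_extend_le hc ((Finset.mem_range.1 hn).le.trans (iht hc)))
    refine (Finset.sum_le_card_nsmul _ _ _ h).trans ?_
    simpa using Nat.mul_le_mul_right _ (iht hc)

end Expr

/-! ### Programs for expressions -/

namespace Cmd

theorem Run.to {c : Cmd} {S S' S'' : Store} {m n : ℕ} (h : Run c S S' m) (hS : S' = S'')
    (hn : m ≤ n) : Run c S S'' n := hS ▸ h.mono hn

/-- The function `I` is a loop invariant, indexed by the word that is left on the counter stack `k`.
-/
theorem run_loop {k : ℕ} {c d : Cmd} {n : ℕ} (I : List Bool → Store) (hI : ∀ l, I l k = l)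
    (l : List Bool)
    (h : ∀ b t, t.length < l.length → Run (cond b d c) (update (I (b :: t)) k t) (I t) n) :
    Run (loop k c d) (I l) (I []) ((n + 1) * l.length + 1) := by
  induction l with
  | nil => simpa using Run.loop_nil (hI [])
  | cons b t ih =>
    have h' := ih fun b' t' ht => h b' t' (by simp; omega)
    refine (Run.loop_cons (hI _) (h b t (by simp)) h').mono ?_
    simp only [List.length_cons]
    ring_nf
    omega

/-- Pour the stack `k` onto the stack `j`. -/
def pour (k j : ℕ) : Cmd := loop k (push j false) (push j true)

theorem run_pour {k j : ℕ} (hkj : k ≠ j) (l : List Bool) : ∀ S : Store, S k = l →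
    Run (pour k j) S (update (update S k []) j (l.reverse ++ S j)) (2 * l.length + 1) := by
  induction l with
  | nil =>
    intro S hS
    refine (Run.loop_nil hS).to (funext fun i => ?_) (by simp)
    simp only [update_apply]; grind
  | cons b t ih =>
    intro S hS
    have h : Run (cond b (push j true) (push j false)) (update S k t)
        (update (update S k t) j (b :: update S k t j)) 1 := by cases b <;> exact Run.push _ _ _
    refine (Run.loop_cons hS h (ih _ (by simp [hkj]))).to (funext fun i => ?_) (by simp; omega)
    simp only [update_apply]; grind

/-- Remove the symbols from the stack `k` and push as many symbols onto the stack `j`. -/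
def count (k j : ℕ) : Cmd := loop k (push j false) (push j false)

theorem run_count {k j : ℕ} (hkj : k ≠ j) (l : List Bool) : ∀ S : Store, S k = l →
    Run (count k j) S (update (update S k []) j (List.replicate l.length false ++ S j))
      (2 * l.length + 1) := by
  induction l with
  | nil =>
    intro S hS
    refine (Run.loop_nil hS).to (funext fun i => ?_) (by simp)
    simp only [update_apply]; grind
  | cons b t ih =>
    intro S hS
    have h : Run (cond b (push j false) (push j false)) (update S k t)
        (update (update S k t) j (false :: update S k t j)) 1 := by cases b <;> exact Run.push _ _ _
    refine (Run.loop_cons hS h (ih _ (by simp [hkj]))).to (funext fun i => ?_) (by simp; omega)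
    simp only [update_apply, List.length_cons, List.replicate_succ']; grind

/-- Empty the stack `k`. -/
def drain (k : ℕ) : Cmd := loop k skip skip

theorem run_drain {k : ℕ} (l : List Bool) : ∀ S : Store, S k = l →
    Run (drain k) S (update S k []) (2 * l.length + 1) := by
  induction l with
  | nil =>
    intro S hS
    refine (Run.loop_nil hS).to (funext fun i => ?_) (by simp)
    simp only [update_apply]; grind
  | cons b t ih =>
    intro S hS
    have h : Run (cond b skip skip) (update S k t) (update S k t) 1 := by
      cases b <;> exact Run.skip _
    refine (Run.loop_cons hS h (ih _ (by simp))).to (by simp) (by simp; omega)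

/-- Pour the stack `k` onto the stack `j` and push its length onto the stack `d`. -/
def pourCount (k j d : ℕ) : Cmd :=
  loop k (seq (push j false) (push d false)) (seq (push j true) (push d false))

theorem run_pourCount {k j d : ℕ} (hkj : k ≠ j) (hkd : k ≠ d) (hjd : j ≠ d) (l : List Bool) :
    ∀ S : Store, S k = l → Run (pourCount k j d) S
      (update (update (update S k []) j (l.reverse ++ S j)) d
        (List.replicate l.length false ++ S d)) (3 * l.length + 1) := by
  induction l with
  | nil =>
    intro S hS
    refine (Run.loop_nil hS).to (funext fun i => ?_) (by simp)
    simp only [update_apply]; grind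
  | cons b t ih =>
    intro S hS
    have h : Run (cond b (seq (push j true) (push d false)) (seq (push j false) (push d false)))
        (update S k t) (update (update (update S k t) j (b :: S j)) d (false :: S d)) 2 := by
      cases b <;>
      · refine (Run.seq (Run.push _ _ _) (Run.push _ _ _)).to (funext fun i => ?_) le_rfl
        simp only [update_apply]; grind
    refine (Run.loop_cons hS h (ih _ (by simp [hkj, hkd]))).to (funext fun i => ?_)
      (by simp; omega)
    simp only [update_apply, List.length_cons, List.replicate_succ']; grind

/-- Remove as many symbols from the stack `d` as there are on the stack `k`, which is emptied. -/
def cut (k d : ℕ) : Cmd := loop k (case d skip skip skip) (case d skip skip skip)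

theorem run_cut {k d : ℕ} (hkd : k ≠ d) (l : List Bool) : ∀ S : Store, S k = l →
    Run (cut k d) S (update (update S k []) d ((S d).drop l.length)) (3 * l.length + 1) := by
  induction l with
  | nil =>
    intro S hS
    refine (Run.loop_nil hS).to (funext fun i => ?_) (by simp)
    simp only [update_apply]; grind
  | cons b t ih =>
    intro S hS
    have h : Run (cond b (case d skip skip skip) (case d skip skip skip)) (update S k t)
        (update (update S k t) d (S d).tail) 2 := by
      have hd : update S k t d = S d := by simp [hkd.symm]
      rw [Bool.cond_self]
      rcases hS' : S d with _ | ⟨b', t'⟩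
      · refine (Run.case_nil (hd.trans hS') (Run.skip _)).to (funext fun i => ?_) le_rfl
        simp only [update_apply]; grind
      · refine (Run.case_cons (hd.trans hS') (n := 1) ?_).to rfl le_rfl
        cases b' <;> exact Run.skip _
    refine (Run.loop_cons hS h (ih _ (by simp [hkd]))).to (funext fun i => ?_) (by simp; omega)
    simp only [update_apply, List.length_cons]
    rcases hS' : S d with _ | ⟨b', t'⟩ <;> grind

/-- Pour at most as many symbols from the stack `k` onto the stack `j` as there are on the stack
`d`, which is emptied. -/
def pourUpTo (d k j : ℕ) : Cmd :=
  loop d (case k skip (push j false) (push j true)) (case k skip (push j false) (push j true))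

theorem run_pourUpTo {d k j : ℕ} (hdk : d ≠ k) (hdj : d ≠ j) (hkj : k ≠ j) (l : List Bool) :
    ∀ S : Store, S d = l → Run (pourUpTo d k j) S
      (update (update (update S d []) k ((S k).drop l.length)) j
        (((S k).take l.length).reverse ++ S j)) (3 * l.length + 1) := by
  induction l with
  | nil =>
    intro S hS
    refine (Run.loop_nil hS).to (funext fun i => ?_) (by simp)
    simp only [update_apply]; grind
  | cons b t ih =>
    intro S hS
    have h : Run (cond b (case k skip (push j false) (push j true))
        (case k skip (push j false) (push j true))) (update S d t)
        (update (update (update S d t) k (S k).tail) j (((S k).take 1).reverse ++ S j)) 2 := by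
      have hk : update S d t k = S k := by simp [hdk.symm]
      rw [Bool.cond_self]
      rcases hS' : S k with _ | ⟨b', t'⟩
      · refine (Run.case_nil (hk.trans hS') (Run.skip _)).to (funext fun i => ?_) le_rfl
        simp only [update_apply]; grind
      · refine (Run.case_cons (hk.trans hS') (n := 1)
          (S' := update (update (update S d t) k t') j (b' :: update (update S d t) k t' j))
          ?_).to (funext fun i => ?_) le_rfl
        · cases b' <;> exact Run.push _ _ _
        · simp only [update_apply]; grind
    refine (Run.loop_cons hS h (ih _ (by simp [hdk, hdj]))).to (funext fun i => ?_)
      (by simp; omega)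
    simp only [update_apply, List.length_cons]
    rcases hS' : S k with _ | ⟨b', t'⟩ <;> grind

end Cmd

/-! ### Compilation of counting expressions and its running time. -/

namespace Expr

/-- The program that evaluates an expression, with the word `i` on the stack `r i`, leaving its
value on the stack `d`; the stacks from `d` on are used. -/
def compile : Expr → (ℕ → ℕ) → ℕ → Cmd
  | length i, r, d => .seq (.pourCount (r i) (d + 1) d) (.pour (d + 1) (r i))
  | one, _, d => .push d false
  | add s t, r, d => .seq (s.compile r d) (.seq (t.compile r (d + 1)) (.count (d + 1) d))
  | sub s t, r, d => .seq (s.compile r d) (.seq (t.compile r (d + 1)) (.cut (d + 1) d))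
  -- The symbols before the tested position are set aside on `d + 1`; the tested symbol is popped
  -- and pushed back, and then the others return.
  | bit i t, r, d => .seq (t.compile r d) (.seq (.pourUpTo d (r i) (d + 1))
      (.seq (.case (r i) .skip (.push (r i) false) (.seq (.push (r i) true) (.push d false)))
        (.pour (d + 1) (r i))))
  | sum t s, r, d =>
    -- Stack `d` counts down the range, `d + 1` holds the index in unary and serves as the new word
    -- `0`, `d + 2` accumulates the sum, and `d + 3` receives each summand.
    let body : Cmd := .seq (s.compile (extend (d + 1) r) (d + 3))
      (.seq (.count (d + 3) (d + 2)) (.push (d + 1) false))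
    .seq (t.compile r d) (.seq (.loop d body body) (.seq (.drain (d + 1)) (.count (d + 2) d)))

/-- A time bound for the evaluation of an expression in terms of the lengths of the words of the
context. -/
noncomputable def time : Expr → Polynomial ℕ
  | length _ => 5 * .X + 2
  | one => 1
  | add s t => s.time + t.time + 2 * t.valBound + 1
  | sub s t => s.time + t.time + 3 * t.valBound + 1
  | bit _ t => t.time + 3 * t.valBound + 2 * .X + 5
  | sum t s => t.time + (s.time.comp (.X + t.valBound) +
      2 * s.valBound.comp (.X + t.valBound) + 3) * t.valBound + 1 +
      (2 * t.valBound + 1) + (2 * (sum t s).valBound + 1)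

/-- Evaluation restores the words and leaves the stacks above `d` empty, so subexpressions can run
one after the other on fresh stacks. The induction varies `r`, `d`, `m` and the context because a
sum adds a word and shifts the workspace. -/
theorem run_compile (e : Expr) : ∀ {r : ℕ → ℕ} {d m : ℕ} {c S : Store},
    (∀ i, r i < d) → (∀ i, S (r i) = c i) → (∀ j, d ≤ j → S j = []) → (∀ i, (c i).length ≤ m) →
    (e.compile r d).Run S (update S d (List.replicate (e.val c) false)) (e.time.eval m) := by
  induction e with
  | length i =>
    intro r d m c S hr hS hd hm
    have hri := hr i
    have hl := hm i
    refine (Cmd.Run.seq (Cmd.run_pourCount (by omega) (by omega) (by omega) _ S rfl)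
      (Cmd.run_pour (by omega) _ _ rfl)).to (funext fun j => ?_) ?_
    · have := hd d le_rfl
      have := hd (d + 1) (by omega)
      have := hS i
      simp only [update_apply, val]; grind
    · have := hd (d + 1) (by omega)
      simp only [update_apply, time]
      simp [this, hS i]
      omega
  | one =>
    intro r d m c S hr hS hd hm
    have := hd d le_rfl
    exact (Cmd.Run.push S d false).to (by simp [this, val]) (by simp [time])
  | add s t ihs iht =>
    intro r d m c S hr hS hd hm
    refine (Cmd.Run.seq (ihs hr hS hd hm) (Cmd.Run.seq (iht (d := d + 1) (c := c) (m := m)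
      (fun i => (hr i).trans (by omega)) (fun i => ?_) (fun j hj => ?_) hm)
      (Cmd.run_count (by omega) _ _ rfl))).to (funext fun j => ?_) ?_
    · rw [update_of_ne (hr i).ne, hS]
    · rw [update_of_ne (by omega), hd j (by omega)]
    · have := hd (d + 1) (by omega)
      simp only [update_apply, val]; grind [List.replicate_append_replicate]
    · have := t.val_le hm
      simp [time]
      omega
  | sub s t ihs iht =>
    intro r d m c S hr hS hd hm
    refine (Cmd.Run.seq (ihs hr hS hd hm) (Cmd.Run.seq (iht (d := d + 1) (c := c) (m := m)
      (fun i => (hr i).trans (by omega)) (fun i => ?_) (fun j hj => ?_) hm)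
      (Cmd.run_cut (by omega) _ _ rfl))).to (funext fun j => ?_) ?_
    · rw [update_of_ne (hr i).ne, hS]
    · rw [update_of_ne (by omega), hd j (by omega)]
    · have := hd (d + 1) (by omega)
      simp only [update_apply, val]; grind
    · have := t.val_le hm
      simp [time]
      omega
  | bit i t iht =>
    intro r d m c S hr hS hd hm
    have hri := hr i
    have hl := hm i
    have ht := t.val_le hm
    have hd₀ := hd d le_rfl
    have hd₁ := hd (d + 1) (by omega)
    have hSi := hS i
    set n := t.val c with hn
    have h₁ := iht hr hS hd hm
    have h₂ := Cmd.run_pourUpTo (d := d) (k := r i) (j := d + 1) (by omega) (by omega) (by omega)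
      _ (update S d (List.replicate n false)) rfl
    -- The remaining word is empty exactly when the position lies past the end of the word; the bit
    -- then counts as `0`.
    have h₃ : Cmd.Run (.case (r i) .skip (.push (r i) false) (.seq (.push (r i) true)
        (.push d false)))
        (update (update S (r i) ((c i).drop n)) (d + 1) ((c i).take n).reverse)
        (update (update (update S (r i) ((c i).drop n)) (d + 1) ((c i).take n).reverse) d
          (List.replicate ((bit i t).val c) false)) 3 := by
      have hk : update (update S (r i) ((c i).drop n)) (d + 1) ((c i).take n).reverse (r i)
          = (c i).drop n := by
        rw [update_of_ne (by omega), update_self]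
      have hv : (bit i t).val c = if (c i)[n]? = some true then 1 else 0 := rfl
      rcases h : (c i).drop n with _ | ⟨b, w⟩
      · have hb : (c i)[n]? = none := by rw [← List.head?_drop, h]; rfl
        rw [h] at hk
        refine (Cmd.Run.case_nil hk (Cmd.Run.skip _)).to (funext fun j => ?_) (by omega)
        simp only [update_apply, hv, hb]; grind
      · have hb : (c i)[n]? = some b := by rw [← List.head?_drop, h]; rfl
        rw [h] at hk
        cases b
        · refine (Cmd.Run.case_cons hk (Cmd.Run.push _ _ _)).to (funext fun j => ?_) (by omega)
          simp only [update_apply, hv, hb]; grind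
        · refine (Cmd.Run.case_cons hk (Cmd.Run.seq (Cmd.Run.push _ _ _)
            (Cmd.Run.push _ _ _))).to (funext fun j => ?_) (by omega)
          simp only [update_apply, hv, hb]; grind
    have h₄ := Cmd.run_pour (k := d + 1) (j := r i) (by omega) _ (update (update (update S (r i)
      ((c i).drop n)) (d + 1) ((c i).take n).reverse) d
      (List.replicate ((bit i t).val c) false)) rfl
    refine (h₁.seq ((h₂.to ?_ le_rfl).seq (h₃.seq h₄))).to (funext fun j => ?_) ?_
    · funext j
      simp only [update_apply]; grind
    · have := List.take_append_drop n (c i)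
      simp only [update_apply]; grind
    · have : (update (update (update S (r i) ((c i).drop n)) (d + 1) ((c i).take n).reverse) d
        (List.replicate ((bit i t).val c) false) (d + 1)).length ≤ m := by
        simp; omega
      simp [time] at this ⊢
      omega
  | sum t s iht ihs =>
    intro r d m c S hr hS hd hm
    have ht := t.val_le hm
    have hd₁ := hd (d + 1) (by omega)
    have hd₂ := hd (d + 2) (by omega)
    have hd₃ := hd (d + 3) (by omega)
    set N := t.val c with hN
    set g : ℕ → ℕ := fun n => s.val (extend (List.replicate n false) c) with hg
    set T := t.valBound.eval m with hT
    -- Loop invariant: when `l` is left on the counter, `N - l.length` summands have been processed.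
    -- That number is the current index, and `d + 2` holds the partial sum.
    set I : List Bool → Store := fun l => update (update (update S (d + 1)
      (List.replicate (N - l.length) false)) (d + 2)
      (List.replicate (∑ n ∈ Finset.range (N - l.length), g n) false)) d l with hI
    set body : Cmd := .seq (s.compile (extend (d + 1) r) (d + 3))
      (.seq (.count (d + 3) (d + 2)) (.push (d + 1) false)) with hbody
    have h₁ := iht hr hS hd hm
    have h₂ := Cmd.run_loop (k := d) (c := body) (d := body)
      (n := s.time.eval (m + T) + 2 * s.valBound.eval (m + T) + 2) I (fun l => by simp [hI])
      (List.replicate N false) (by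
        intro b w hw
        rw [Bool.cond_self, List.length_replicate] at *
        set n := N - (w.length + 1) with hn
        have hn' : N - w.length = n + 1 := by omega
        have hc := length_extend_le hm (show n ≤ T by omega)
        have hv := s.val_le hc
        refine (Cmd.Run.seq (ihs (c := extend (List.replicate n false) c) (m := m + T)
          (fun i => ?_) (fun i => ?_) (fun j hj => ?_) hc)
          (Cmd.Run.seq (Cmd.run_count (by omega) _ _ rfl) (Cmd.Run.push _ _ _))).to
          (funext fun j => ?_) ?_
        · rcases i with _ | i
          · simp [extend]
          · have := hr i
            simp only [extend]; omega
        · rcases i with _ | i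
          · simp [extend, hI, hn]
          · have := hr i
            have := hS i
            simp only [hI, update_apply, extend]; grind
        · simp only [hI, update_apply]; grind
        · simp only [hI, update_apply, List.length_cons, ← hn, hn', Finset.sum_range_succ,
            List.replicate_succ]
          grind [List.replicate_append_replicate]
        · simp
          omega)
    have h₃ := Cmd.run_drain (k := d + 1) _ (I []) rfl
    have h₄ := Cmd.run_count (k := d + 2) (j := d) (by omega) _ (update (I []) (d + 1) []) rfl
    have hsum : (sum t s).val c = ∑ n ∈ Finset.range N, g n := rfl
    have h₂' : Cmd.Run (.loop d body body) (update S d (List.replicate N false)) (I [])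
        ((s.time.eval (m + T) + 2 * s.valBound.eval (m + T) + 3) * N + 1) := by
      have : update S d (List.replicate N false) = I (List.replicate N false) := by
        funext j
        simp only [hI, update_apply, List.length_replicate, Nat.sub_self, Finset.range_zero,
          Finset.sum_empty, List.replicate_zero]
        rcases eq_or_ne j d with rfl | h
        · simp
        rcases eq_or_ne j (d + 1) with rfl | h'
        · simp [hd₁]
        rcases eq_or_ne j (d + 2) with rfl | h''
        · simp [hd₂]
        · simp [h, h', h'']
      rw [this]
      exact h₂.to rfl (by simp)
    refine (h₁.seq (h₂'.seq (h₃.seq h₄))).to (funext fun j => ?_) ?_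
    · simp only [hI, hsum, update_apply, List.length_nil, Nat.sub_zero]
      rcases eq_or_ne j d with rfl | h
      · simp
      rcases eq_or_ne j (d + 1) with rfl | h'
      · simp [hd₁]
      rcases eq_or_ne j (d + 2) with rfl | h''
      · simp [hd₂]
      · simp [h, h', h'']
    · have hv := (sum t s).val_le hm
      have := Nat.mul_le_mul_left (s.time.eval (m + T) + 2 * s.valBound.eval (m + T) + 3) ht
      simp only [time, Polynomial.eval_add, Polynomial.eval_mul, Polynomial.eval_comp,
        Polynomial.eval_X, Polynomial.eval_ofNat, Polynomial.eval_one, ← hT]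
      simp [hI, ← hsum]
      omega

end Expr

/-- Whether an expression has a positive value in the context given by three words. -/
noncomputable def Expr.accepts (e : Expr) (t : List Bool × List Bool × List Bool) : Bool :=
  decide (0 < e.val (tripleStore t.1 t.2.1 t.2.2))

theorem Expr.polyTime_accepts (e : Expr) : PolyTime e.accepts := by
  -- The words are moved to the stacks 3, 4, 5, which also undoes their reversal. All further words
  -- of the context are empty and are represented by stack 0, which is empty during the evaluation.
  set r : ℕ → ℕ := fun i => if i < 3 then i + 3 else 0 with hr
  refine polyTime_of_run (c := .seq (.seq (.pour 0 3) (.seq (.pour 1 4) (.pour 2 5)))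
    (.seq (e.compile r 6) (.seq (.case 6 (.push 0 false) (.push 0 true) (.push 0 true))
      (.seq (.drain 6) (.seq (.drain 5) (.seq (.drain 4) (.drain 3)))))))
    (e.time + 2 * e.valBound + 4 * .X + 9) fun x u v => ?_
  set c := tripleStore x u v with hc
  set S : Store := fun k => if k < 3 then [] else tripleStore x u v (k - 3) with hS
  set m := x.length + u.length + v.length + 2 with hm
  have hcm : ∀ i, (c i).length ≤ m := by
    intro i
    simp only [hc, tripleStore]
    split_ifs <;> (try simp only [List.length_nil]) <;> omega
  have h₁ : Cmd.Run (.seq (.pour 0 3) (.seq (.pour 1 4) (.pour 2 5)))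
      (tripleStore x.reverse u.reverse v.reverse) S (2 * m) := by
    refine (Cmd.Run.seq (Cmd.run_pour (by omega) x.reverse _ rfl) (Cmd.Run.seq
      (Cmd.run_pour (by omega) u.reverse _ rfl) (Cmd.run_pour (by omega) v.reverse _ rfl))).to
      (funext fun j => ?_) (by simp; omega)
    rcases j with _ | _ | _ | _ | _ | _ | j <;> simp [hS, tripleStore]
  have h₂ := e.run_compile (r := r) (d := 6) (m := m) (c := c) (S := S)
    (fun i => by simp only [hr]; split_ifs <;> omega)
    (fun i => by simp only [hr, hS, hc, tripleStore]; grind)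
    (fun j hj => by simp only [hS, tripleStore]; grind) hcm
  set n := e.val c with hn
  have hv := e.val_le hcm
  have h₃ : Cmd.Run (.case 6 (.push 0 false) (.push 0 true) (.push 0 true))
      (update S 6 (List.replicate n false))
      (update (update S 6 (List.replicate (n - 1) false)) 0 [e.accepts (x, u, v)]) 2 := by
    have ha : e.accepts (x, u, v) = decide (0 < n) := rfl
    rw [ha]
    rcases n with _ | n
    · refine (Cmd.Run.case_nil (by simp) (Cmd.Run.push _ _ _)).to (funext fun j => ?_) le_rfl
      simp only [hS, update_apply]; grind
    · refine (Cmd.Run.case_cons (b := false) (t := List.replicate n false)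
        (by simp [List.replicate_succ]) (Cmd.Run.push _ _ _)).to (funext fun j => ?_) le_rfl
      simp only [hS, update_apply]; grind
  -- The rest of the value and the three words are discarded, so that only the answer bit on stack 0
  -- remains.
  refine (h₁.seq (h₂.seq (h₃.seq (Cmd.Run.seq (Cmd.run_drain _ _ rfl) (Cmd.Run.seq
    (Cmd.run_drain _ _ rfl) (Cmd.Run.seq (Cmd.run_drain _ _ rfl)
    (Cmd.run_drain _ _ rfl))))))).to (funext fun j => ?_) ?_
  · simp only [hS, tripleStore, update_apply]; grind
  · simp [hS, tripleStore]
    omega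

end Complexity

namespace Complexity

open Function

/-! ### Definable words, terms and predicates -/

/-- Drop the first word of a context. -/
def tail (c : Store) : Store := fun i => c (i + 1)

/-- The number given by the first word of a context. -/
def head (c : Store) : ℕ := (c 0).length

open Classical in
/-- The indicator of a proposition. -/
noncomputable def ind (P : Prop) : ℕ := if P then 1 else 0

theorem ind_pos {P : Prop} : 0 < ind P ↔ P := by
  unfold ind; split_ifs <;> simp_all

theorem ind_true {P : Prop} (h : P) : ind P = 1 := if_pos h

theorem ind_false {P : Prop} (h : ¬P) : ind P = 0 := if_neg h

/-- The word `f c` is one of the words of the context `c`. -/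
class Wd (f : Store → List Bool) : Prop where
  out : ∃ i, ∀ c : Store, c i = f c

/-- The number `f c` is given by an expression. -/
class Tm (f : Store → ℕ) : Prop where
  out : ∃ e : Expr, ∀ c, e.val c = f c

/-- The predicate `P` has an indicator that is given by an expression. -/
class Df (P : Store → Prop) : Prop where
  out : Tm fun c => ind (P c)

/-- Rename the words of a context below a binder. -/
def liftRename (r : ℕ → ℕ) : ℕ → ℕ := extend 0 fun i => r i + 1

/-- Rename the words in an expression. -/
def Expr.rename : Expr → (ℕ → ℕ) → Expr
  | length i, r => length (r i)
  | one, _ => one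
  | add s t, r => add (s.rename r) (t.rename r)
  | sub s t, r => sub (s.rename r) (t.rename r)
  | bit i t, r => bit (r i) (t.rename r)
  | sum t s, r => sum (t.rename r) (s.rename (liftRename r))

theorem Expr.val_rename (e : Expr) : ∀ (r : ℕ → ℕ) (c : Store),
    (e.rename r).val c = e.val fun i => c (r i) := by
  induction e with
  | length i => intros; rfl
  | one => intros; rfl
  | add s t ihs iht => intro r c; simp [rename, val, ihs, iht]
  | sub s t ihs iht => intro r c; simp [rename, val, ihs, iht]
  | bit i t iht => intro r c; simp [rename, val, iht]
  | sum t s iht ihs =>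
    intro r c
    simp only [rename, val, iht, ihs]
    refine Finset.sum_congr rfl fun n _ => congrArg _ (funext fun i => ?_)
    rcases i with _ | i <;> rfl

/-! ### Closure properties of definability. -/

section instances

variable {f g : Store → ℕ} {P Q : Store → Prop} {X : Store → List Bool}

instance (i : ℕ) : Wd (fun c => c i) := ⟨i, fun _ => rfl⟩

theorem Wd.tail (hX : Wd X) : Wd (fun c => X (tail c)) := by
  obtain ⟨i, h⟩ := hX
  exact ⟨i + 1, fun c => h (Complexity.tail c)⟩

theorem Tm.tail (hf : Tm f) : Tm (fun c => f (tail c)) := by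
  obtain ⟨e, h⟩ := hf
  exact ⟨e.rename fun i => i + 1, fun c => (e.val_rename _ c).trans (h _)⟩

/-- Each bounded quantifier or sum pushes its index onto the context, so a parameter used below `k`
binders is read through `k` applications of `tail`. -/
instance [h : Wd X] : Wd (fun c => X (tail c)) := h.tail
instance [h : Wd X] : Wd (fun c => X (tail (tail c))) := h.tail.tail
instance [h : Wd X] : Wd (fun c => X (tail (tail (tail c)))) := h.tail.tail.tail
instance [h : Wd X] : Wd (fun c => X (tail (tail (tail (tail c))))) := h.tail.tail.tail.tail
instance [h : Tm f] : Tm (fun c => f (tail c)) := h.tail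
instance [h : Tm f] : Tm (fun c => f (tail (tail c))) := h.tail.tail
instance [h : Tm f] : Tm (fun c => f (tail (tail (tail c)))) := h.tail.tail.tail
instance [h : Tm f] : Tm (fun c => f (tail (tail (tail (tail c))))) := h.tail.tail.tail.tail

instance : Tm head := ⟨.length 0, fun _ => rfl⟩

instance [h : Wd X] : Tm (fun c => (X c).length) := by
  obtain ⟨i, h⟩ := h
  exact ⟨.length i, fun c => by rw [Expr.val, h c]⟩

instance [hf : Tm f] [hg : Tm g] : Tm (fun c => f c + g c) := by
  obtain ⟨s, hs⟩ := hf
  obtain ⟨t, ht⟩ := hg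
  exact ⟨.add s t, fun c => by rw [Expr.val, hs, ht]⟩

instance [hf : Tm f] [hg : Tm g] : Tm (fun c => f c - g c) := by
  obtain ⟨s, hs⟩ := hf
  obtain ⟨t, ht⟩ := hg
  exact ⟨.sub s t, fun c => by rw [Expr.val, hs, ht]⟩

instance Tm.const (n : ℕ) : Tm (fun _ => n) := by
  induction n with
  | zero => exact ⟨.sub .one .one, fun _ => rfl⟩
  | succ n ih =>
    have : Tm (fun _ => 1) := ⟨.one, fun _ => rfl⟩
    infer_instance

instance Tm.sum {f : Store → ℕ → ℕ} [hg : Tm g] [hf : Tm fun c => f (Complexity.tail c) (head c)] :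
    Tm (fun c => ∑ n ∈ Finset.range (g c), f c n) := by
  obtain ⟨s, hs⟩ := hf
  obtain ⟨t, ht⟩ := hg
  refine ⟨.sum t s, fun c => ?_⟩
  rw [Expr.val, ht]
  refine Finset.sum_congr rfl fun n _ => ?_
  rw [hs]
  simp only [head, extend, List.length_replicate]
  rfl

instance [hf : Tm f] [hg : Tm g] : Tm (fun c => f c * g c) := by
  have : Tm (fun c => ∑ _n ∈ Finset.range (f c), g c) := inferInstance
  simpa using this

instance (p : Polynomial ℕ) [hf : Tm f] : Tm (fun c => p.eval (f c)) := by
  induction p using Polynomial.induction_on with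
  | C a => simpa using Tm.const a
  | add p q hp hq => simpa using (inferInstance : Tm fun c => p.eval (f c) + q.eval (f c))
  | monomial n a h =>
    have := (inferInstance : Tm fun c => (Polynomial.C a * Polynomial.X ^ n).eval (f c) * f c)
    simpa [pow_succ, mul_assoc] using this

instance [h : Df P] : Tm (fun c => ind (P c)) := h.out

theorem Df.congr (h : Df P) (hPQ : ∀ c, P c ↔ Q c) : Df Q :=
  (funext fun c => propext (hPQ c) : P = Q) ▸ h

/-- Truncated subtraction applied twice, `1 - (1 - f c)`, turns every positive value into `1`.
Connectives and quantifiers may therefore be expressed by any term that is positive exactly when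
they hold. -/
theorem Df.of_pos [hf : Tm f] (h : ∀ c, P c ↔ 0 < f c) : Df P := by
  refine ⟨?_⟩
  have : Tm fun c => 1 - (1 - f c) := inferInstance
  refine (funext fun c => ?_ : (fun c => ind (P c)) = _) ▸ this
  by_cases hc : P c
  · rw [ind_true hc]
    have := (h c).1 hc
    omega
  · rw [ind_false hc]
    have : ¬0 < f c := fun h' => hc ((h c).2 h')
    omega

instance [hP : Df P] : Df (fun c => ¬P c) :=
  .of_pos (f := fun c => 1 - ind (P c)) fun c => by
    by_cases h : P c
    · rw [ind_true h]; simp [h]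
    · rw [ind_false h]; simp [h]

instance [hP : Df P] [hQ : Df Q] : Df (fun c => P c ∧ Q c) :=
  .of_pos (f := fun c => ind (P c) * ind (Q c)) fun c => by
    rw [pos_iff_ne_zero, mul_ne_zero_iff, ← pos_iff_ne_zero, ← pos_iff_ne_zero, ind_pos, ind_pos]

instance [hP : Df P] [hQ : Df Q] : Df (fun c => P c ∨ Q c) :=
  .of_pos (f := fun c => ind (P c) + ind (Q c)) fun c => by
    simp [ind_pos]

instance [hP : Df P] [hQ : Df Q] : Df (fun c => P c → Q c) :=
  .congr (P := fun c => ¬P c ∨ Q c) inferInstance fun c => by tauto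

instance [hP : Df P] [hQ : Df Q] : Df (fun c => P c ↔ Q c) :=
  .congr (P := fun c => (P c → Q c) ∧ (Q c → P c)) inferInstance fun c => by tauto

instance [hf : Tm f] [hg : Tm g] : Df (fun c => f c < g c) :=
  .of_pos (f := fun c => g c - f c) fun c => by omega

instance [hf : Tm f] [hg : Tm g] : Df (fun c => f c ≤ g c) :=
  .congr (P := fun c => f c < g c + 1) inferInstance fun c => by omega

instance [hf : Tm f] [hg : Tm g] : Df (fun c => f c = g c) :=
  .congr (P := fun c => f c ≤ g c ∧ g c ≤ f c) inferInstance fun c => by omega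

instance Df.exists {P : Store → ℕ → Prop} [hf : Tm f]
    [hP : Df fun c => P (Complexity.tail c) (head c)] : Df (fun c => ∃ n < f c, P c n) :=
  .of_pos (f := fun c => ∑ n ∈ Finset.range (f c), ind (P c n)) fun c => by
    simp [Finset.sum_pos_iff, ind_pos]

instance Df.forall {P : Store → ℕ → Prop} [hf : Tm f]
    [hP : Df fun c => P (Complexity.tail c) (head c)] : Df (fun c => ∀ n < f c, P c n) :=
  .congr (P := fun c => ¬∃ n < f c, ¬P c n) inferInstance fun c => by push Not; rfl

/-- The position `i` of `w` holds a `1`. -/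
def Bit (w : List Bool) (i : ℕ) : Prop := w[i]? = some true

instance [hX : Wd X] [hf : Tm f] : Df (fun c => Bit (X c) (f c)) := by
  obtain ⟨i, hX⟩ := hX
  obtain ⟨t, ht⟩ := hf
  refine ⟨.bit i t, fun c => ?_⟩
  rw [Expr.val, hX c, ht]
  unfold ind Bit
  congr

/-- The entry of a three-dimensional table of numbers that is written in a word in unary. -/
noncomputable def table (w : List Bool) (M t a b : ℕ) : ℕ :=
  ∑ m ∈ Finset.range M, ind (Bit w (((t * M + a) * M + b) * M + m))

instance {M t a b : Store → ℕ} [Wd X] [Tm M] [Tm t] [Tm a] [Tm b] :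
    Tm (fun c => table (X c) (M c) (t c) (a c) (b c)) := by
  unfold table; infer_instance

end instances

theorem polyTime_of_df {P : Store → Prop} (h : Df P) :
    ∃ f, PolyTime f ∧ ∀ x u v, f (x, u, v) = true ↔ P (tripleStore x u v) := by
  obtain ⟨e, he⟩ := h.out
  refine ⟨_, e.polyTime_accepts, fun x u v => ?_⟩
  rw [Expr.accepts, decide_eq_true_iff, he, ind_pos]

/-- The cell `(t, a, b)` owns `M` consecutive positions, the first `g t a b` of which are set to
`1`. Four coordinates below `M` give the length `M ^ 4`. Reading counts the ones in a cell, so every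
word whatsoever decodes to tables and no format has to be checked. -/
theorem exists_table (M : ℕ) (g : ℕ → ℕ → ℕ → ℕ) :
    ∃ w : List Bool, w.length = M ^ 4 ∧ ∀ t < M, ∀ a < M, ∀ b < M, g t a b ≤ M →
      table w M t a b = g t a b := by
  refine ⟨List.ofFn fun i : Fin (M ^ 4) =>
    decide (i % M < g (i / M / M / M) (i / M / M % M) (i / M % M)), by simp, ?_⟩
  intro t ht a ha b hb hg
  have hM : 0 < M := by omega
  have key : ∀ m < M, Bit (List.ofFn fun i : Fin (M ^ 4) =>
      decide (i % M < g (i / M / M / M) (i / M / M % M) (i / M % M)))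
      (((t * M + a) * M + b) * M + m) ↔ m < g t a b := by
    intro m hm
    have h₁ : t * M + a < M ^ 2 := by nlinarith
    have h₂ : (t * M + a) * M + b < M ^ 3 := by
      have : (t * M + a + 1) * M ≤ M ^ 2 * M := Nat.mul_le_mul_right _ h₁
      nlinarith
    have h₃ : ((t * M + a) * M + b) * M + m < M ^ 4 := by
      have : ((t * M + a) * M + b + 1) * M ≤ M ^ 3 * M := Nat.mul_le_mul_right _ h₂
      nlinarith
    have hdiv : ∀ q r, r < M → (q * M + r) / M = q ∧ (q * M + r) % M = r := fun q r hr => by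
      rw [Nat.add_comm, Nat.add_mul_div_right _ _ hM, Nat.add_mul_mod_self_right,
        Nat.div_eq_of_lt hr, Nat.mod_eq_of_lt hr]
      simp
    rw [Bit, List.getElem?_ofFn, dif_pos h₃]
    simp [hdiv _ _ hm, hdiv _ _ hb, hdiv _ _ ha]
  rw [table, Finset.sum_congr rfl fun m hm => congrArg ind (propext (key m (Finset.mem_range.1 hm)))]
  have hind : ∀ m, ind (m < g t a b) = if m < g t a b then 1 else 0 := fun m => by
    unfold ind; congr
  simp only [hind]
  rw [Finset.sum_boole, Nat.cast_id]
  have : {m ∈ Finset.range M | m < g t a b} = Finset.range (g t a b) := by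
    ext m; simp; omega
  rw [this, Finset.card_range]

end Complexity

namespace Complexity

open Function

/-! ### Reading words -/

/-- The word `l` stands in `x` at the positions from `a` to `e`. -/
def Seg (x : List Bool) : ℕ → List Bool → ℕ → Prop
  | a, [], e => a = e
  | a, b :: l, e => x[a]? = some b ∧ Seg x (a + 1) l e

section Seg

variable {x : List Bool}

theorem seg_append {l l' : List Bool} {a e : ℕ} :
    Seg x a (l ++ l') e ↔ ∃ m, Seg x a l m ∧ Seg x m l' e := by
  induction l generalizing a with
  | nil => simp [Seg]
  | cons b l ih => simp [Seg, ih, and_assoc]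

theorem Seg.eq_add {l : List Bool} {a e : ℕ} (h : Seg x a l e) : e = a + l.length := by
  induction l generalizing a with
  | nil => exact h.symm
  | cons b l ih => rw [ih h.2, List.length_cons]; omega

theorem Seg.le_length {l : List Bool} {a e : ℕ} (h : Seg x a l e) (hl : l ≠ []) :
    e ≤ x.length := by
  induction l generalizing a with
  | nil => exact absurd rfl hl
  | cons b l ih =>
    have hb := (List.getElem?_eq_some_iff.1 h.1).1
    rcases l with _ | ⟨b', l⟩
    · have : a + 1 = e := h.2
      omega
    · exact ih h.2 (by simp)

theorem seg_length_iff {l : List Bool} {a : ℕ} (ha : a ≤ x.length) :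
    Seg x a l x.length ↔ x.drop a = l := by
  induction l generalizing a with
  | nil => simp [Seg]; omega
  | cons b l ih =>
    rcases ha.eq_or_lt with rfl | ha
    · simp [Seg]
    · rw [Seg, ih ha, List.getElem?_eq_getElem ha, Option.some_inj,
        List.drop_eq_getElem_cons ha, List.cons.injEq]

theorem getElem?_eq_some_false {a : ℕ} : x[a]? = some false ↔ a < x.length ∧ ¬Bit x a := by
  rw [Bit, List.getElem?_eq_some_iff, List.getElem?_eq_some_iff]
  constructor
  · rintro ⟨h, h'⟩; exact ⟨h, by simp [h']⟩
  · rintro ⟨h, h'⟩; exact ⟨h, by simpa [h] using h'⟩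

/-- The number `k` is written in `x` at the position `a`. -/
def Idx (x : List Bool) (a k : ℕ) : Prop :=
  (∀ i < k, Bit x (a + i)) ∧ a + k < x.length ∧ ¬Bit x (a + k)

theorem idx_iff_seg {a k : ℕ} : Idx x a k ↔ Seg x a (encodeIndex k) (a + k + 1) := by
  induction k generalizing a with
  | zero => simp [Idx, encodeIndex, Seg, getElem?_eq_some_false]
  | succ k ih =>
    have : encodeIndex (k + 1) = true :: encodeIndex k := rfl
    rw [this, Seg, show a + (k + 1) + 1 = a + 1 + k + 1 by omega, ← ih, Idx, Idx,
      Nat.forall_lt_succ_left, show a + (k + 1) = a + 1 + k by omega, and_assoc]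
    simp only [add_zero, Bit, Nat.add_assoc, Nat.add_comm 1]

theorem seg_encodeIndex_iff {a k e : ℕ} :
    Seg x a (encodeIndex k) e ↔ Idx x a k ∧ e = a + k + 1 := by
  constructor
  · intro h
    have he : e = a + k + 1 := by simpa [encodeIndex, Nat.add_assoc] using h.eq_add
    subst he
    exact ⟨idx_iff_seg.2 h, rfl⟩
  · rintro ⟨h, rfl⟩; exact idx_iff_seg.1 h

theorem Idx.unique {a k k' : ℕ} (h : Idx x a k) (h' : Idx x a k') : k = k' := by
  rcases lt_trichotomy k k' with hk | hk | hk
  · exact absurd (h'.1 k hk) h.2.2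
  · exact hk
  · exact absurd (h.1 k' hk) h'.2.2

/-- The boundaries between the blocks become a function `pos`, which can be guessed as a table. A
concatenation of variable length then becomes a family of independent local conditions. -/
theorem seg_flatMap {n : ℕ} (w : Fin n → List Bool) {a e : ℕ} :
    Seg x a ((List.finRange n).flatMap w) e ↔ ∃ pos : ℕ → ℕ, pos 0 = a ∧ pos n = e ∧
      ∀ i : Fin n, Seg x (pos i) (w i) (pos (i + 1)) := by
  induction n generalizing a with
  | zero =>
    simp only [List.finRange_zero, List.flatMap_nil, Seg, IsEmpty.forall_iff, and_true]
    exact ⟨fun h => ⟨fun _ => a, rfl, h⟩, fun ⟨pos, h, h'⟩ => h ▸ h'⟩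
  | succ n ih =>
    rw [List.finRange_succ, List.flatMap_cons, List.flatMap_map, seg_append]
    simp only [ih]
    constructor
    · rintro ⟨m, hm, pos, rfl, rfl, h⟩
      exact ⟨extend a pos, rfl, rfl, Fin.cases hm h⟩
    · rintro ⟨pos, rfl, rfl, h⟩
      exact ⟨pos 1, h 0, fun i => pos (i + 1), rfl, rfl, fun i => h i.succ⟩

theorem seg_map {n : ℕ} (f : Fin n → Bool) {a e : ℕ} :
    Seg x a ((List.finRange n).map f) e ↔ e = a + n ∧ ∀ i : Fin n, x[a + i]? = some (f i) := by
  induction n generalizing a with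
  | zero => simp [Seg, eq_comm]
  | succ n ih =>
    rw [List.finRange_succ, List.map_cons, List.map_map, Seg, ih, Fin.forall_fin_succ]
    simp only [Fin.val_zero, add_zero, comp_apply, Fin.val_succ, Nat.add_assoc, Nat.add_comm 1]
    tauto

theorem seg_matrix {n : ℕ} (f : Fin n → Fin n → Bool) {a e : ℕ} :
    Seg x a ((List.finRange n).flatMap fun i => (List.finRange n).map (f i)) e ↔
      e = a + n * n ∧ ∀ i j : Fin n, x[a + i * n + j]? = some (f i j) := by
  rw [seg_flatMap]
  simp only [seg_map]
  constructor
  · rintro ⟨pos, rfl, rfl, h⟩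
    have hpos : ∀ i ≤ n, pos i = pos 0 + i * n := by
      intro i
      induction i with
      | zero => simp
      | succ i ih => intro hi; rw [(h ⟨i, hi⟩).1, ih (by omega)]; ring
    exact ⟨hpos n le_rfl, fun i j => hpos i i.2.le ▸ (h i).2 j⟩
  · rintro ⟨rfl, h⟩
    exact ⟨fun i => a + i * n, by simp, rfl, fun i => ⟨by ring, h i⟩⟩

theorem seg_flatMap_unique {α : Type} {enc : α → List Bool}
    (henc : ∀ {a e e' g g'}, Seg x a (enc g) e → Seg x a (enc g') e' → g = g' ∧ e = e') {n : ℕ}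
    {g g' : Fin n → α} {pos pos' : ℕ → ℕ} (h₀ : pos 0 = pos' 0)
    (h : ∀ i : Fin n, Seg x (pos i) (enc (g i)) (pos (i + 1)))
    (h' : ∀ i : Fin n, Seg x (pos' i) (enc (g' i)) (pos' (i + 1))) :
    g = g' ∧ pos n = pos' n := by
  have hpos : ∀ i ≤ n, pos i = pos' i := by
    intro i
    induction i with
    | zero => exact fun _ => h₀
    | succ i ih =>
      intro hi
      have := h ⟨i, hi⟩
      rw [ih (by omega)] at this
      exact (henc this (h' ⟨i, hi⟩)).2
  exact ⟨funext fun i => (henc (hpos i i.2.le ▸ h i) (h' i)).1, hpos n le_rfl⟩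

end Seg

/-! ### Tables for formulas -/

section Formulas

variable {x : List Bool} {V : ℕ}

theorem _root_.BoolFormula.encode_ne_nil (φ : BoolFormula (Fin V)) : φ.encode ≠ [] := by
  cases φ <;> simp [BoolFormula.encode]

/-- The code is prefix-free: the leading bits determine the connective, and induction settles the
end of each subformula. Hence a formula and its end are determined by the start position alone. -/
theorem seg_encode_unique {φ ψ : BoolFormula (Fin V)} {a e e' : ℕ} :
    Seg x a φ.encode e → Seg x a ψ.encode e' → φ = ψ ∧ e = e' := by
  induction φ generalizing ψ a e e' with
  | tru => cases ψ <;> simp [BoolFormula.encode, Seg] <;> grind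
  | fls => cases ψ <;> simp [BoolFormula.encode, Seg] <;> grind
  | var v =>
    cases ψ with
    | var w =>
      simp only [BoolFormula.encode, List.cons_append, List.nil_append, Seg, seg_encodeIndex_iff]
      rintro ⟨_, _, h, rfl⟩ ⟨_, _, h', rfl⟩
      obtain rfl := Fin.ext (h.unique h')
      exact ⟨rfl, rfl⟩
    | _ => simp [BoolFormula.encode, Seg]; grind
  | neg φ ih =>
    cases ψ with
    | neg ψ =>
      simp only [BoolFormula.encode, List.cons_append, List.nil_append, Seg]
      rintro ⟨_, _, h⟩ ⟨_, _, h'⟩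
      obtain ⟨rfl, rfl⟩ := ih h h'
      exact ⟨rfl, rfl⟩
    | _ => simp [BoolFormula.encode, Seg]; grind
  | and φ φ' ih ih' =>
    cases ψ with
    | and ψ ψ' =>
      simp only [BoolFormula.encode, List.cons_append, List.nil_append, Seg, seg_append]
      rintro ⟨_, _, _, m, h₁, h₂⟩ ⟨_, _, _, m', h₁', h₂'⟩
      obtain ⟨rfl, rfl⟩ := ih h₁ h₁'
      obtain ⟨rfl, rfl⟩ := ih' h₂ h₂'
      exact ⟨rfl, rfl⟩
    | _ => simp [BoolFormula.encode, Seg]; grind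
  | or φ φ' ih ih' =>
    cases ψ with
    | or ψ ψ' =>
      simp only [BoolFormula.encode, List.cons_append, List.nil_append, Seg, seg_append]
      rintro ⟨_, _, _, m, h₁, h₂⟩ ⟨_, _, _, m', h₁', h₂'⟩
      obtain ⟨rfl, rfl⟩ := ih h₁ h₁'
      obtain ⟨rfl, rfl⟩ := ih' h₂ h₂'
      exact ⟨rfl, rfl⟩
    | _ => simp [BoolFormula.encode, Seg]; grind

/-- `fin a` is `0` or the end of a formula that starts at the position `a`: local conditions. -/
def FormulaTable (x : List Bool) (V : ℕ) (fin : ℕ → ℕ) : Prop :=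
  ∀ a < x.length, fin a ≠ 0 → fin a ≤ x.length ∧
    ((¬Bit x a ∧ ¬Bit x (a + 1) ∧ fin a = a + 3) ∨
    (¬Bit x a ∧ Bit x (a + 1) ∧ ∃ k < V, Idx x (a + 2) k ∧ fin a = a + 2 + k + 1) ∨
    (Bit x a ∧ ¬Bit x (a + 1) ∧ a + 2 < x.length ∧ fin (a + 2) = fin a) ∨
    -- The second subformula starts where the first one ends. The condition `a < fin (a + 3)` forces
    -- that position to the right of `a`, which makes the recursion well-founded.
    (Bit x a ∧ Bit x (a + 1) ∧ a + 3 < x.length ∧ a < fin (a + 3) ∧ fin (a + 3) < x.length ∧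
      fin (fin (a + 3)) = fin a))

/-- `tr a` is the truth value of the formula that starts at the position `a`: local conditions. -/
def TruthTable (x : List Bool) (fin : ℕ → ℕ) (θ tr : ℕ → Prop) : Prop :=
  ∀ a < x.length, fin a ≠ 0 →
    (¬Bit x a → ¬Bit x (a + 1) → (tr a ↔ ¬Bit x (a + 2))) ∧
    -- The code of the variable `k` has two tag bits, `k` ones and a zero, so it ends at `a + 3 + k`
    -- and `k` is recovered from `fin`.
    (¬Bit x a → Bit x (a + 1) → (tr a ↔ θ (fin a - (a + 3)))) ∧
    (Bit x a → ¬Bit x (a + 1) → (tr a ↔ ¬tr (a + 2))) ∧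
    (Bit x a → Bit x (a + 1) → ¬Bit x (a + 2) → (tr a ↔ tr (a + 3) ∧ tr (fin (a + 3)))) ∧
    (Bit x a → Bit x (a + 1) → Bit x (a + 2) → (tr a ↔ tr (a + 3) ∨ tr (fin (a + 3))))

theorem getElem?_eq_some_decide {a : ℕ} {b : Bool} :
    x[a]? = some b ↔ a < x.length ∧ (Bit x a ↔ b = true) := by
  cases b
  · simp [getElem?_eq_some_false]
  · simp only [Bit, iff_true]
    exact ⟨fun h => ⟨(List.getElem?_eq_some_iff.1 h).1, h⟩, fun h => h.2⟩

/-- Subformulas start further to the right, so induction on the distance to the end of `x` assembles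
the formula from the local conditions. -/
theorem FormulaTable.exists_formula {fin : ℕ → ℕ} (h : FormulaTable x V fin) {a : ℕ}
    (ha : a < x.length) (hf : fin a ≠ 0) :
    ∃ φ : BoolFormula (Fin V), Seg x a φ.encode (fin a) := by
  induction hn : x.length - a using Nat.strong_induction_on generalizing a with
  | _ n ih =>
    obtain ⟨hle, h₁ | ⟨h₁, h₂, k, hk, hi, he⟩ | ⟨h₁, h₂, h₃, h₄⟩ | ⟨h₁, h₂, h₃, h₄, h₅, h₆⟩⟩ :=
      h a ha hf
    · by_cases hb : Bit x (a + 2)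
      · refine ⟨.fls, ?_⟩
        simp only [BoolFormula.encode, Seg, getElem?_eq_some_decide]
        simp [h₁, hb]; omega
      · refine ⟨.tru, ?_⟩
        simp only [BoolFormula.encode, Seg, getElem?_eq_some_decide]
        simp [h₁, hb]; omega
    · refine ⟨.var ⟨k, hk⟩, ?_⟩
      simp only [BoolFormula.encode, List.cons_append, List.nil_append, Seg, seg_encodeIndex_iff,
        getElem?_eq_some_decide]
      simp [h₁, h₂, hi, he]; omega
    · obtain ⟨φ, hφ⟩ := ih _ (by omega) h₃ (h₄ ▸ hf) rfl
      refine ⟨.neg φ, ?_⟩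
      simp only [BoolFormula.encode, List.cons_append, List.nil_append, Seg,
        getElem?_eq_some_decide]
      rw [h₄] at hφ
      exact ⟨by simp [h₁, ha], by simp [h₂]; omega, hφ⟩
    · obtain ⟨φ, hφ⟩ := ih _ (by omega) h₃ (by omega) rfl
      obtain ⟨ψ, hψ⟩ := ih _ (by omega) h₅ (h₆ ▸ hf) rfl
      rw [h₆] at hψ
      by_cases hb : Bit x (a + 2)
      · refine ⟨.or φ ψ, ?_⟩
        simp only [BoolFormula.encode, List.cons_append, List.nil_append, Seg, seg_append,
          getElem?_eq_some_decide]
        exact ⟨by simp [h₁, ha], by simp [h₂]; omega, by simp [hb]; omega, _, hφ, hψ⟩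
      · refine ⟨.and φ ψ, ?_⟩
        simp only [BoolFormula.encode, List.cons_append, List.nil_append, Seg, seg_append,
          getElem?_eq_some_decide]
        exact ⟨by simp [h₁, ha], by simp [h₂]; omega, by simp [hb]; omega, _, hφ, hψ⟩

theorem FormulaTable.eq_of_seg {fin : ℕ → ℕ} (h : FormulaTable x V fin) {a e : ℕ}
    (hf : fin a ≠ 0) {φ : BoolFormula (Fin V)} (hφ : Seg x a φ.encode e) : fin a = e := by
  have h₁ := hφ.eq_add
  have h₂ := hφ.le_length φ.encode_ne_nil
  have h₃ := List.length_pos_iff.2 φ.encode_ne_nil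
  obtain ⟨ψ, hψ⟩ := h.exists_formula (by omega) hf
  exact (seg_encode_unique hψ hφ).2

/-- Structural induction. At a marked position the formula table also marks the immediate
subformulas, so the local truth rules apply to them, and `FormulaTable.eq_of_seg` locates the second
operand. -/
theorem TruthTable.holds_iff {fin : ℕ → ℕ} {θ tr : ℕ → Prop} (h : FormulaTable x V fin)
    (ht : TruthTable x fin θ tr) {φ : BoolFormula (Fin V)} : ∀ {a e : ℕ}, fin a ≠ 0 →
    Seg x a φ.encode e → (tr a ↔ φ.Holds fun v : Fin V => θ v) := by
  have hlt : ∀ {a e : ℕ} {φ : BoolFormula (Fin V)}, Seg x a φ.encode e → a < x.length := by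
    intro a e φ hφ
    have h₁ := hφ.eq_add
    have h₂ := hφ.le_length φ.encode_ne_nil
    have h₃ := List.length_pos_iff.2 φ.encode_ne_nil
    omega
  induction φ with
  | tru =>
    intro a e hf hφ
    have := ht a (hlt hφ) hf
    simp only [BoolFormula.encode, Seg, getElem?_eq_some_decide] at hφ
    simp_all [BoolFormula.Holds]
  | fls =>
    intro a e hf hφ
    have := ht a (hlt hφ) hf
    simp only [BoolFormula.encode, Seg, getElem?_eq_some_decide] at hφ
    simp_all [BoolFormula.Holds]
  | var v =>
    intro a e hf hφ
    have h₁ := ht a (hlt hφ) hf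
    have h₂ := h.eq_of_seg hf hφ
    simp only [BoolFormula.encode, List.cons_append, List.nil_append, Seg, seg_encodeIndex_iff,
        getElem?_eq_some_decide] at hφ
    obtain ⟨h₃, h₄, h₅, h₆⟩ := hφ
    rw [h₁.2.1 (by simpa using h₃.2) (by simpa using h₄.2), BoolFormula.Holds,
      show fin a - (a + 3) = v by omega]
  | neg φ ih =>
    intro a e hf hφ
    have h₁ := ht a (hlt hφ) hf
    have h₂ := h a (hlt hφ) hf
    simp only [BoolFormula.encode, List.cons_append, List.nil_append, Seg,
        getElem?_eq_some_decide] at hφ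
    obtain ⟨⟨_, h₃⟩, ⟨_, h₄⟩, h₅⟩ := hφ
    simp only [iff_true, Bool.false_eq_true, iff_false] at h₃ h₄
    simp only [h₃, h₄, not_true, not_false_eq_true, false_and, true_and, false_or, or_false]
      at h₂
    rw [h₁.2.2.1 h₃ h₄, BoolFormula.Holds, ih (h₂.2.2 ▸ hf) h₅]
  | and φ ψ ihφ ihψ =>
    intro a e hf hφ
    have h₁ := ht a (hlt hφ) hf
    have h₂ := h a (hlt hφ) hf
    simp only [BoolFormula.encode, List.cons_append, List.nil_append, Seg, seg_append,
        getElem?_eq_some_decide] at hφ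
    obtain ⟨⟨_, h₃⟩, ⟨_, h₄⟩, ⟨_, h₅⟩, m, hφ, hψ⟩ := hφ
    simp only [iff_true, Bool.false_eq_true, iff_false] at h₃ h₄ h₅
    simp only [h₃, h₄, not_true, false_and, true_and, false_or] at h₂
    have hm₀ : fin (a + 3) ≠ 0 := by omega
    have hm := h.eq_of_seg hm₀ hφ
    have hm' : fin m ≠ 0 := by rw [← hm, h₂.2.2.2.2]; exact hf
    rw [h₁.2.2.2.1 h₃ h₄ h₅, BoolFormula.Holds, ihφ hm₀ hφ, hm, ihψ hm' hψ]
  | or φ ψ ihφ ihψ =>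
    intro a e hf hφ
    have h₁ := ht a (hlt hφ) hf
    have h₂ := h a (hlt hφ) hf
    simp only [BoolFormula.encode, List.cons_append, List.nil_append, Seg, seg_append,
        getElem?_eq_some_decide] at hφ
    obtain ⟨⟨_, h₃⟩, ⟨_, h₄⟩, ⟨_, h₅⟩, m, hφ, hψ⟩ := hφ
    simp only [iff_true] at h₃ h₄ h₅
    simp only [h₃, h₄, not_true, false_and, true_and, false_or] at h₂
    have hm₀ : fin (a + 3) ≠ 0 := by omega
    have hm := h.eq_of_seg hm₀ hφ
    have hm' : fin m ≠ 0 := by rw [← hm, h₂.2.2.2.2]; exact hf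
    rw [h₁.2.2.2.2 h₃ h₄ h₅, BoolFormula.Holds, ihφ hm₀ hφ, hm, ihψ hm' hψ]

/-- `fin a` is `0` or the end of a formula that starts at the position `a`, and not `0` if there
is such a formula. -/
def IsFormulaEnd (x : List Bool) (V : ℕ) (fin : ℕ → ℕ) : Prop :=
  ∀ a < x.length, (∀ (φ : BoolFormula (Fin V)) (e : ℕ), Seg x a φ.encode e → fin a = e) ∧
    (fin a ≠ 0 → ∃ (φ : BoolFormula (Fin V)) (e : ℕ), Seg x a φ.encode e)

theorem Seg.lt_length {l : List Bool} {a e : ℕ} (h : Seg x a l e) (hl : l ≠ []) :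
    a < x.length := by
  have h₁ := h.eq_add
  have h₂ := h.le_length hl
  have h₃ := List.length_pos_iff.2 hl
  omega

theorem Seg.lt {l : List Bool} {a e : ℕ} (h : Seg x a l e) (hl : l ≠ []) : a < e := by
  have h₁ := h.eq_add
  have h₃ := List.length_pos_iff.2 hl
  omega

theorem IsFormulaEnd.formulaTable {fin : ℕ → ℕ} (h : IsFormulaEnd x V fin) :
    FormulaTable x V fin := by
  intro a ha hf
  obtain ⟨φ, e, hφ⟩ := (h a ha).2 hf
  obtain rfl := (h a ha).1 φ e hφ
  refine ⟨hφ.le_length φ.encode_ne_nil, ?_⟩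
  cases φ with
  | tru =>
    simp only [BoolFormula.encode, Seg, getElem?_eq_some_decide] at hφ
    simp_all
  | fls =>
    simp only [BoolFormula.encode, Seg, getElem?_eq_some_decide] at hφ
    simp_all
  | var v =>
    simp only [BoolFormula.encode, List.cons_append, List.nil_append, Seg, seg_encodeIndex_iff,
      getElem?_eq_some_decide] at hφ
    exact Or.inr (Or.inl ⟨by simpa using hφ.1.2, by simpa using hφ.2.1.2, v, v.2, hφ.2.2⟩)
  | neg φ =>
    simp only [BoolFormula.encode, List.cons_append, List.nil_append, Seg,
      getElem?_eq_some_decide] at hφ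
    have hlt := hφ.2.2.lt_length φ.encode_ne_nil
    exact Or.inr (Or.inr (Or.inl ⟨by simpa using hφ.1.2, by simpa using hφ.2.1.2, hlt,
      (h _ hlt).1 φ _ hφ.2.2⟩))
  | and φ ψ =>
    simp only [BoolFormula.encode, List.cons_append, List.nil_append, Seg, seg_append,
      getElem?_eq_some_decide] at hφ
    obtain ⟨h₁, h₂, _, m, hφ, hψ⟩ := hφ
    have hlt := hφ.lt_length φ.encode_ne_nil
    have hlt' := hψ.lt_length ψ.encode_ne_nil
    have hm := (h _ hlt).1 φ _ hφ
    have := hφ.lt φ.encode_ne_nil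
    have hm' := (h _ hlt').1 ψ _ hψ
    refine Or.inr (Or.inr (Or.inr ⟨by simpa using h₁.2, by simpa using h₂.2, hlt, ?_⟩))
    change fin (a + 3) = m at hm
    rw [hm]
    exact ⟨by omega, hlt', hm'⟩
  | or φ ψ =>
    simp only [BoolFormula.encode, List.cons_append, List.nil_append, Seg, seg_append,
      getElem?_eq_some_decide] at hφ
    obtain ⟨h₁, h₂, _, m, hφ, hψ⟩ := hφ
    have hlt := hφ.lt_length φ.encode_ne_nil
    have hlt' := hψ.lt_length ψ.encode_ne_nil
    have hm := (h _ hlt).1 φ _ hφ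
    have := hφ.lt φ.encode_ne_nil
    have hm' := (h _ hlt').1 ψ _ hψ
    refine Or.inr (Or.inr (Or.inr ⟨by simpa using h₁.2, by simpa using h₂.2, hlt, ?_⟩))
    change fin (a + 3) = m at hm
    rw [hm]
    exact ⟨by omega, hlt', hm'⟩

theorem IsFormulaEnd.truthTable {fin : ℕ → ℕ} (h : IsFormulaEnd x V fin) {θ tr : ℕ → Prop}
    (ht : ∀ a < x.length, ∀ (φ : BoolFormula (Fin V)) (e : ℕ), Seg x a φ.encode e →
      (tr a ↔ φ.Holds fun v : Fin V => θ v)) : TruthTable x fin θ tr := by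
  intro a ha hf
  obtain ⟨φ, e, hφ⟩ := (h a ha).2 hf
  have he := (h a ha).1 φ e hφ
  rw [ht a ha φ e hφ]
  cases φ with
  | tru =>
    simp only [BoolFormula.encode, Seg, getElem?_eq_some_decide] at hφ
    simp_all [BoolFormula.Holds]
  | fls =>
    simp only [BoolFormula.encode, Seg, getElem?_eq_some_decide] at hφ
    simp_all [BoolFormula.Holds]
  | var v =>
    simp only [BoolFormula.encode, List.cons_append, List.nil_append, Seg, seg_encodeIndex_iff,
      getElem?_eq_some_decide] at hφ
    obtain ⟨⟨_, h₃⟩, ⟨_, h₄⟩, h₅, h₆⟩ := hφ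
    have hv : fin a - (a + 3) = v := by omega
    simp_all [BoolFormula.Holds]
  | neg φ =>
    simp only [BoolFormula.encode, List.cons_append, List.nil_append, Seg,
      getElem?_eq_some_decide] at hφ
    have := ht _ (hφ.2.2.lt_length φ.encode_ne_nil) _ _ hφ.2.2
    simp_all [BoolFormula.Holds]
  | and φ ψ =>
    simp only [BoolFormula.encode, List.cons_append, List.nil_append, Seg, seg_append,
      getElem?_eq_some_decide] at hφ
    obtain ⟨h₁, h₂, _, m, hφ, hψ⟩ := hφ
    have hlt := hφ.lt_length φ.encode_ne_nil
    have hm : fin (a + 3) = m := (h _ hlt).1 φ _ hφ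
    have h₃ : tr (a + 3) ↔ _ := ht _ hlt φ _ hφ
    have h₄ := ht _ (hψ.lt_length ψ.encode_ne_nil) ψ _ hψ
    simp_all [BoolFormula.Holds]
  | or φ ψ =>
    simp only [BoolFormula.encode, List.cons_append, List.nil_append, Seg, seg_append,
      getElem?_eq_some_decide] at hφ
    obtain ⟨h₁, h₂, _, m, hφ, hψ⟩ := hφ
    have hlt := hφ.lt_length φ.encode_ne_nil
    have hm : fin (a + 3) = m := (h _ hlt).1 φ _ hφ
    have h₃ : tr (a + 3) ↔ _ := ht _ hlt φ _ hφ
    have h₄ := ht _ (hψ.lt_length ψ.encode_ne_nil) ψ _ hψ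
    simp_all [BoolFormula.Holds]

theorem exists_isFormulaEnd (x : List Bool) (V : ℕ) :
    ∃ fin : ℕ → ℕ, (∀ a, fin a ≤ x.length) ∧ IsFormulaEnd x V fin := by
  classical
  refine ⟨fun a => if h : ∃ (φ : BoolFormula (Fin V)) (e : ℕ), Seg x a φ.encode e then
    h.choose_spec.choose else 0, fun a => ?_, fun a _ => ⟨fun φ e hφ => ?_, fun h => ?_⟩⟩
  · simp only
    split_ifs with h
    · exact h.choose_spec.choose_spec.le_length (BoolFormula.encode_ne_nil _)
    · exact Nat.zero_le _
  · have h : ∃ (φ : BoolFormula (Fin V)) (e : ℕ), Seg x a φ.encode e := ⟨φ, e, hφ⟩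
    refine (dif_pos h).trans ?_
    exact (seg_encode_unique h.choose_spec.choose_spec hφ).2
  · by_contra h'
    exact h (dif_neg h')

end Formulas

end Complexity

namespace Complexity

open Function

/-! ### Reading instances -/

section Instances

variable {x : List Bool} {P V : ℕ}

/-- The word `x` encodes an instance with the given data; `own y` is the position of the owner of
`y`, `A` that of the adjacency matrix, `pos p` that of the objective of `p`, and `pos P` that of the
specification. -/
structure Describes (x : List Bool) (G : GameArena (Fin P) (Fin V))
    (obj : Fin P → BoolFormula (Fin V)) (spec : BoolFormula (Fin V)) (A : ℕ) (own pos : ℕ → ℕ) :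
    Prop where
  numPlayers : Idx x 0 P
  numVertices : Idx x (P + 1) V
  own_zero : own 0 = P + 1 + V + 1
  idx_own : ∀ y : Fin V, Idx x (own y) (G.owner y)
  own_succ : ∀ y : Fin V, own (y + 1) = own y + G.owner y + 1
  idx_init : Idx x (own V) G.init
  matrix : A = own V + G.init + 1
  edges : ∀ y z : Fin V, x[A + y * V + z]? = some (decide ((y, z) ∈ G.edges))
  pos_zero : pos 0 = A + V * V
  seg_objective : ∀ p : Fin P, Seg x (pos p) (obj p).encode (pos (p + 1))
  seg_spec : Seg x (pos P) spec.encode x.length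

theorem exists_describes {G : GameArena (Fin P) (Fin V)} {obj : Fin P → BoolFormula (Fin V)}
    {spec : BoolFormula (Fin V)} (h : CKRInstance.encode ⟨P, V, G, obj, spec⟩ = x) :
    ∃ A own pos, Describes x G obj spec A own pos := by
  have h := (seg_length_iff (Nat.zero_le x.length)).2 (List.drop_zero.trans h.symm)
  simp only [CKRInstance.encode, seg_append, seg_flatMap (fun v => encodeIndex (G.owner v)),
    seg_matrix, seg_flatMap (fun p => (obj p).encode), seg_encodeIndex_iff] at h
  obtain ⟨_, ⟨_, ⟨A, ⟨_, ⟨_, ⟨_, ⟨hP, rfl⟩, hV, rfl⟩, own, h₀, rfl, hown⟩, hinit, hA⟩, rfl, hE⟩,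
    pos, hpos₀, rfl, hpos⟩, hspec⟩ := h
  rw [zero_add] at *
  exact ⟨A, own, pos, hP, hV, h₀, fun y => (hown y).1, fun y => (hown y).2, hinit, hA, hE,
    hpos₀, hpos, hspec⟩

theorem Describes.encode_eq {G : GameArena (Fin P) (Fin V)} {obj : Fin P → BoolFormula (Fin V)}
    {spec : BoolFormula (Fin V)} {A : ℕ} {own pos : ℕ → ℕ} (h : Describes x G obj spec A own pos) :
    CKRInstance.encode ⟨P, V, G, obj, spec⟩ = x := by
  refine .trans ?_ (List.drop_zero (l := x))
  refine ((seg_length_iff (Nat.zero_le x.length)).1 ?_).symm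
  simp only [CKRInstance.encode, seg_append, seg_flatMap (fun v => encodeIndex (G.owner v)),
    seg_matrix, seg_flatMap (fun p => (obj p).encode), seg_encodeIndex_iff]
  refine ⟨_, ⟨_, ⟨A, ⟨_, ⟨_, ⟨_, ⟨h.numPlayers, rfl⟩, ?_, rfl⟩, own, ?_, rfl,
    fun y => ⟨h.idx_own y, h.own_succ y⟩⟩, h.idx_init, h.matrix⟩, rfl, h.edges⟩,
    pos, h.pos_zero, rfl, h.seg_objective⟩, h.seg_spec⟩
  · simpa using h.numVertices
  · simpa using h.own_zero

/-- All parts are self-delimiting, so reading from left to right leaves no choice. This rules out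
that a guessed parse of `x` yields a different instance. -/
theorem encode_injective : Injective CKRInstance.encode := by
  rintro ⟨P, V, G, obj, spec⟩ ⟨P', V', G', obj', spec'⟩ h
  obtain ⟨A, own, pos, h⟩ := exists_describes h
  obtain ⟨A', own', pos', h'⟩ := exists_describes
    (rfl : CKRInstance.encode ⟨P', V', G', obj', spec'⟩ = _)
  obtain rfl := h.numPlayers.unique h'.numPlayers
  obtain rfl := h.numVertices.unique h'.numVertices
  obtain ⟨howner, hown⟩ := seg_flatMap_unique (enc := fun p : Fin P => encodeIndex p)
    (pos := own) (pos' := own') (g := G.owner) (g' := G'.owner) (by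
      intro a e e' g g' hg hg'
      rw [seg_encodeIndex_iff] at hg hg'
      obtain rfl := Fin.ext (hg.1.unique hg'.1)
      exact ⟨rfl, hg.2.trans hg'.2.symm⟩)
    (h.own_zero.trans h'.own_zero.symm)
    (fun i => seg_encodeIndex_iff.2 ⟨h.idx_own i, h.own_succ i⟩)
    (fun i => seg_encodeIndex_iff.2 ⟨h'.idx_own i, h'.own_succ i⟩)
  have hinit : G.init = G'.init := Fin.ext ((hown ▸ h.idx_init).unique h'.idx_init)
  have hA : A = A' := by rw [h.matrix, h'.matrix, hown, hinit]
  subst hA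
  have hE : G.edges = G'.edges := by
    ext ⟨y, z⟩
    have := (h.edges y z).symm.trans (h'.edges y z)
    simpa using this
  obtain ⟨hobj, hpos⟩ := seg_flatMap_unique (enc := BoolFormula.encode) seg_encode_unique
    (h.pos_zero.trans h'.pos_zero.symm) h.seg_objective h'.seg_objective
  have hspec := (seg_encode_unique (hpos ▸ h.seg_spec) h'.seg_spec).1
  obtain ⟨owner, init, edges, total⟩ := G
  obtain ⟨owner', init', edges', total'⟩ := G'
  obtain rfl : owner = owner' := howner
  obtain rfl : init = init' := hinit
  obtain rfl : edges = edges' := hE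
  rw [hobj, hspec]

/-- Local conditions for `x` to encode an instance. -/
def Header (x : List Bool) (P V i₀ A : ℕ) (own pos fin : ℕ → ℕ) : Prop :=
  Idx x 0 P ∧ Idx x (P + 1) V ∧ own 0 = P + 1 + V + 1 ∧
  (∀ y < V, ∃ o < P, Idx x (own y) o ∧ own (y + 1) = own y + o + 1) ∧
  i₀ < V ∧ Idx x (own V) i₀ ∧ A = own V + i₀ + 1 ∧
  (∀ y < V, ∃ z < V, Bit x (A + y * V + z)) ∧ pos 0 = A + V * V ∧
  (∀ p < P, fin (pos p) ≠ 0 ∧ pos p < x.length ∧ fin (pos p) = pos (p + 1)) ∧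
  fin (pos P) ≠ 0 ∧ pos P < x.length ∧ fin (pos P) = x.length ∧ FormulaTable x V fin

theorem Header.exists_describes {i₀ A : ℕ} {own pos fin : ℕ → ℕ}
    (h : Header x P V i₀ A own pos fin) :
    ∃ (G : GameArena (Fin P) (Fin V)) (obj : Fin P → BoolFormula (Fin V))
      (spec : BoolFormula (Fin V)), Describes x G obj spec A own pos ∧ G.init.val = i₀ := by
  classical
  obtain ⟨hP, hV, h₀, hown, hi₀, hinit, hA, htotal, hpos₀, hpos, hspec₀, hspec, hspec', hF⟩ := h
  choose owner howner using fun y : Fin V => hown y y.2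
  choose obj hobj using fun p : Fin P => hF.exists_formula (hpos p p.2).2.1 (hpos p p.2).1
  obtain ⟨spec, hs⟩ := hF.exists_formula hspec hspec₀
  -- The predicate `Bit` fails both at a `0` and past the end of `x`. This bound shows that the
  -- whole matrix lies inside `x`, so that absent edges are genuine zeros.
  have hle : A + V * V < x.length := by
    rw [← hpos₀]
    rcases P with _ | P
    · exact hspec
    · exact (hpos 0 (by omega)).2.1
  refine ⟨⟨fun y => ⟨owner y, (howner y).1⟩, ⟨i₀, hi₀⟩,
    Finset.univ.filter fun e => Bit x (A + e.1 * V + e.2), fun y => ?_⟩, obj, spec,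
    ⟨hP, hV, h₀, fun y => (howner y).2.1, fun y => (howner y).2.2, hinit, hA, fun y z => ?_,
      hpos₀, fun p => ?_, ?_⟩, rfl⟩
  · obtain ⟨z, hz, h⟩ := htotal y y.2
    exact ⟨⟨z, hz⟩, by simpa using h⟩
  · rw [getElem?_eq_some_decide]
    have h₁ : (y.val + 1) * V ≤ V * V := Nat.mul_le_mul_right _ y.2
    rw [Nat.add_mul, one_mul] at h₁
    have := z.2
    exact ⟨by omega, by simp⟩
  · rw [← (hpos p p.2).2.2]
    exact hobj p
  · rwa [hspec'] at hs

theorem Describes.pos_le {G : GameArena (Fin P) (Fin V)} {obj : Fin P → BoolFormula (Fin V)}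
    {spec : BoolFormula (Fin V)} {A : ℕ} {own pos : ℕ → ℕ} (h : Describes x G obj spec A own pos)
    {p : ℕ} (hp : p ≤ P) : pos p < x.length := by
  rcases hp.eq_or_lt with rfl | hp
  · exact h.seg_spec.lt_length spec.encode_ne_nil
  · exact (h.seg_objective ⟨p, hp⟩).lt_length (BoolFormula.encode_ne_nil _)

theorem Describes.own_le {G : GameArena (Fin P) (Fin V)} {obj : Fin P → BoolFormula (Fin V)}
    {spec : BoolFormula (Fin V)} {A : ℕ} {own pos : ℕ → ℕ} (h : Describes x G obj spec A own pos)
    {y : ℕ} (hy : y ≤ V) : own y < x.length := by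
  rcases hy.eq_or_lt with rfl | hy
  · have := h.idx_init.2.1
    omega
  · have := (h.idx_own ⟨y, hy⟩).2.1
    simp only at this
    omega

theorem Describes.header {G : GameArena (Fin P) (Fin V)} {obj : Fin P → BoolFormula (Fin V)}
    {spec : BoolFormula (Fin V)} {A : ℕ} {own pos own' pos' fin : ℕ → ℕ}
    (h : Describes x G obj spec A own pos) (hown : ∀ y ≤ V, own' y = own y)
    (hpos : ∀ p ≤ P, pos' p = pos p) (hfin : IsFormulaEnd x V fin) :
    Header x P V G.init A own' pos' fin := by
  refine ⟨h.numPlayers, h.numVertices, (hown 0 (by omega)).trans h.own_zero, fun y hy => ?_,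
    G.init.2, hown V le_rfl ▸ h.idx_init, hown V le_rfl ▸ h.matrix, fun y hy => ?_,
    (hpos 0 (by omega)).trans h.pos_zero, fun p hp => ?_, ?_, ?_, ?_, hfin.formulaTable⟩
  · refine ⟨_, (G.owner ⟨y, hy⟩).2, ?_, ?_⟩
    · rw [hown y (by omega)]; exact h.idx_own ⟨y, hy⟩
    · rw [hown y (by omega), hown (y + 1) (by omega)]; exact h.own_succ ⟨y, hy⟩
  · obtain ⟨z, hz⟩ := G.total ⟨y, hy⟩
    refine ⟨z, z.2, ?_⟩
    have := h.edges ⟨y, hy⟩ z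
    rw [getElem?_eq_some_decide] at this
    exact this.2.2 (by simpa using hz)
  · have hs := h.seg_objective ⟨p, hp⟩
    have hlt := h.pos_le hp.le
    have hf := (hfin _ hlt).1 _ _ hs
    have := hs.lt (BoolFormula.encode_ne_nil _)
    simp only at hf this
    rw [hpos p hp.le, hpos (p + 1) hp, hf]
    exact ⟨by omega, hlt, rfl⟩
  · rw [hpos P le_rfl, (hfin _ (h.pos_le le_rfl)).1 _ _ h.seg_spec]
    have := h.pos_le le_rfl
    omega
  · rw [hpos P le_rfl]; exact h.pos_le le_rfl
  · rw [hpos P le_rfl, (hfin _ (h.pos_le le_rfl)).1 _ _ h.seg_spec]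

end Instances

end Complexity

/-! ### From common knowledge of rationality to rationality in all worlds. -/

namespace EpistemicModel

variable {P V W : Type} {G : GameArena P V} (M : EpistemicModel G W)

/-- The restriction of a model to a set of worlds. -/
def restrict (C : Set W) : EpistemicModel G C where
  rel p w w' := M.rel p w w'
  equiv p := ⟨fun w => (M.equiv p).refl w, fun h => (M.equiv p).symm h,
    fun h h' => (M.equiv p).trans h h'⟩
  strat p w := M.strat p w
  strat_eq p w w' h := M.strat_eq p w w' h

theorem size_restrict_le [Fintype P] [Finite W] (C : Set W) : (M.restrict C).size ≤ M.size := by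
  have h : Nat.card C ≤ Nat.card W := Nat.card_le_card_of_injective _ Subtype.val_injective
  refine Nat.add_le_add (Nat.add_le_add h (Finset.sum_le_sum fun p _ => ?_))
    (Nat.mul_le_mul_right _ h)
  refine Nat.card_le_card_of_injective (fun e => ⟨(e.1.1, e.1.2), e.2⟩) ?_
  rintro ⟨⟨a, b⟩, h⟩ ⟨⟨a', b'⟩, h'⟩ hab
  simpa [Subtype.ext_iff] using hab

/-- Since `C` is closed under the relations, the information cell of `w` is unchanged, and any
deviation that refutes rationality in the restriction refutes it in `M`. -/
theorem mem_rationalFor_restrict [DecidableEq P] {α : P → Set (ℕ → V)} {p : P} {C : Set W}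
    (hC : ∀ w ∈ C, ∀ w', M.rel p w w' → w' ∈ C) {w : C} (hw : (w : W) ∈ M.rationalFor α p) :
    w ∈ (M.restrict C).rationalFor α p := by
  rintro ⟨t, h, w', hr, h'⟩
  exact hw ⟨t, fun w' hr => h ⟨w', hC w w.2 w' hr⟩ hr, w', hr, h'⟩

/-- Level `i + 1` of mutual knowledge at `w` is, for each player, level `i` at all worlds considered
possible. -/
theorem rel_mem_commonKnowledge {E : Set W} {p : P} {w w' : W}
    (hw : w ∈ M.commonKnowledge E) (hr : M.rel p w w') : w' ∈ M.commonKnowledge E := by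
  simp only [KripkeFrame.commonKnowledge, Set.mem_iInter] at hw ⊢
  intro i _
  have := hw (i + 1) (by omega)
  rw [Function.iterate_succ_apply'] at this
  exact Set.mem_iInter.1 this p w' hr

theorem commonKnowledge_subset [Nonempty P] {E : Set W} : M.commonKnowledge E ⊆ E := by
  intro w hw
  obtain ⟨p⟩ := ‹Nonempty P›
  simp only [KripkeFrame.commonKnowledge, Set.mem_iInter] at hw
  exact Set.mem_iInter.1 (hw 1 le_rfl) p w ((M.equiv p).refl w)

end EpistemicModel

theorem KripkeFrame.commonKnowledge_univ {P W : Type} (F : KripkeFrame P W) :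
    F.commonKnowledge Set.univ = Set.univ := by
  have h : F.mutualKnowledge Set.univ = Set.univ := by
    simp [KripkeFrame.mutualKnowledge, KripkeFrame.knows]
  simp [KripkeFrame.commonKnowledge, Function.iterate_fixed h]

/-- Common knowledge of rationality can be replaced by rationality in all worlds. -/
theorem mem_VPCKR_iff {b : Polynomial ℕ} {I : CKRInstance} :
    I ∈ VPCKR b ↔ ∀ (W : Type) (_ : Finite W) (M : EpistemicModel I.arena W),
      M.size ≤ b.eval I.arena.size →
      (∀ w p, w ∈ M.rationalFor (fun p => I.arena.muller (I.objective p)) p) →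
      ∀ w, I.arena.outcome (M.profile w) ∈ I.arena.muller I.spec := by
  constructor
  · intro h W _ M hM hR w
    have hR' : M.rational (fun p => I.arena.muller (I.objective p)) = Set.univ :=
      Set.eq_univ_of_forall fun w => Set.mem_iInter.2 fun p => hR w p
    refine h _ ⟨W, ‹_›, M, hM, w, ?_, rfl⟩
    rw [hR', M.commonKnowledge_univ]
    trivial
  · rintro h _ ⟨W, _, M, hM, w, hw, rfl⟩
    -- Without players every event would be common knowledge; the owner of the initial vertex
    -- excludes this case.
    have : Nonempty (Fin I.numPlayers) := ⟨I.arena.owner I.arena.init⟩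
    set C := M.commonKnowledge (M.rational fun p => I.arena.muller (I.objective p)) with hC
    exact h C inferInstance (M.restrict C) ((M.size_restrict_le C).trans hM)
      (fun w p => M.mem_rationalFor_restrict (fun _ hw _ hr => M.rel_mem_commonKnowledge hw hr)
        (Set.mem_iInter.1 (M.commonKnowledge_subset w.2) p)) ⟨w, hw⟩

/-! ### Outcomes of positional profiles are ultimately periodic. -/

namespace GameArena

variable {P V : Type} (G : GameArena P V)

/-- The successor that a profile chooses at a vertex. -/
def next (s : G.PosProfile) (y : V) : V := (s (G.owner y)).1 ⟨y, rfl⟩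

theorem next_deviate [DecidableEq P] (s : G.PosProfile) {p : P} (t : G.PosStrategy p) (y : V) :
    G.next (G.deviate s p t) y = if h : G.owner y = p then t.1 ⟨y, h⟩ else G.next s y := by
  unfold next deviate
  split_ifs with h
  · subst h
    exact congrArg (fun r : G.PosStrategy (G.owner y) => r.1 ⟨y, rfl⟩)
      (Function.update_self (β := G.PosStrategy) _ _ _)
  · exact congrArg (fun r : G.PosStrategy (G.owner y) => r.1 ⟨y, rfl⟩)
      (Function.update_of_ne (β := G.PosStrategy) h _ _)

/-- Among the first `|V| + 1` vertices two coincide, at times `i < j ≤ |V|`, and from `i` on the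
play has period `j - i ≤ |V|`. A late visit can be moved back by periods into the window from `|V|`
to `2|V|`, and a visit in the window recurs forever. -/
theorem mem_inf_outcome {G : GameArena P V} [Fintype V] (s : G.PosProfile) (y : V) :
    y ∈ inf (G.outcome s) ↔
      ∃ i < 2 * Fintype.card V + 1, Fintype.card V ≤ i ∧ G.outcome s i = y := by
  obtain ⟨i, j, hij, hj, he⟩ : ∃ i j, i < j ∧ j ≤ Fintype.card V ∧
      G.outcome s i = G.outcome s j := by
    obtain ⟨i, j, hne, h⟩ := Fintype.exists_ne_map_eq_of_card_lt
      (fun i : Fin (Fintype.card V + 1) => G.outcome s i) (by simp)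
    rcases lt_or_gt_of_ne hne with hlt | hlt
    · exact ⟨i, j, hlt, by omega, h⟩
    · exact ⟨j, i, hlt, by omega, h.symm⟩
  have hstep : ∀ n, G.outcome s (n + 1) = G.next s (G.outcome s n) := fun _ => rfl
  have hper : ∀ n, G.outcome s (i + n) = G.outcome s (j + n) := by
    intro n
    induction n with
    | zero => exact he
    | succ n ih => rw [← Nat.add_assoc, ← Nat.add_assoc, hstep, hstep, ih]
  have hper' : ∀ k n, i ≤ n → G.outcome s (n + k * (j - i)) = G.outcome s n := by
    intro k
    induction k with
    | zero => simp
    | succ k ih =>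
      intro n hn
      rw [← ih n hn]
      have := hper (n + k * (j - i) - i)
      rw [show i + (n + k * (j - i) - i) = n + k * (j - i) by omega,
        show j + (n + k * (j - i) - i) = n + (k + 1) * (j - i) by
          rw [Nat.add_mul, one_mul]; omega] at this
      exact this.symm
  constructor
  · intro h
    obtain ⟨n, hn, hy⟩ := h (Fintype.card V)
    induction n using Nat.strong_induction_on with
    | _ n ih =>
      by_cases hlt : n < 2 * Fintype.card V + 1
      · exact ⟨n, hlt, hn, hy⟩
      · refine ih (n - (j - i)) (by omega) (by omega) ?_
        rw [← hper' 1 (n - (j - i)) (by omega), ← hy]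
        congr 1
        omega
  · rintro ⟨n, -, hn, rfl⟩ m
    refine ⟨n + m * (j - i), ?_, hper' m n (by omega)⟩
    have := Nat.mul_le_mul_left m (show 1 ≤ j - i by omega)
    omega

end GameArena

namespace Complexity

open Function

/-! ### Epistemic models given by tables -/

section Models

variable {x : List Bool} {P V N : ℕ} {G : GameArena (Fin P) (Fin V)}
  {obj : Fin P → BoolFormula (Fin V)} {spec : BoolFormula (Fin V)} {A : ℕ} {own pos : ℕ → ℕ}
  {W : Type} {M : EpistemicModel G W} {isW : ℕ → Prop} {st cl : ℕ → ℕ → ℕ} {e : W → ℕ}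

/-- The worlds of `M` are the numbers below `N` with `isW`, the profiles are given by `st`, and the
equivalence class of a world for the player `p` by `cl p`. -/
structure Represents (M : EpistemicModel G W) (N : ℕ) (isW : ℕ → Prop) (st cl : ℕ → ℕ → ℕ)
    (e : W → ℕ) : Prop where
  injective : Injective e
  range_iff : ∀ n, (∃ w, e w = n) ↔ n < N ∧ isW n
  strat : ∀ w (y : Fin V), st (e w) y = G.next (M.profile w) y
  rel : ∀ (p : Fin P) w w', cl p (e w) = cl p (e w') ↔ M.rel p w w'

/-- The size of a model that is given by tables. -/
noncomputable def tableSize (P V N : ℕ) (isW : ℕ → Prop) (cl : ℕ → ℕ → ℕ) : ℕ :=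
  ∑ n ∈ Finset.range N, ind (isW n) +
  ∑ p ∈ Finset.range P, ∑ n ∈ Finset.range N, ∑ n' ∈ Finset.range N,
    ind (isW n ∧ isW n' ∧ cl p n = cl p n') +
  (∑ n ∈ Finset.range N, ind (isW n)) * V

/-- The size of an arena that is given by its adjacency matrix. -/
noncomputable def matrixSize (x : List Bool) (P V A : ℕ) : ℕ :=
  P + V + ∑ y ∈ Finset.range V, ∑ z ∈ Finset.range V, ind (Bit x (A + y * V + z))

/-- The tables `isW`, `st`, `cl` describe a model of size at most `b` of the size of the arena. -/
def ValidModel (b : Polynomial ℕ) (x : List Bool) (P V A N : ℕ) (own : ℕ → ℕ) (isW : ℕ → Prop)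
    (st cl : ℕ → ℕ → ℕ) : Prop :=
  (∀ n < N, isW n → ∀ y < V, st n y < V ∧ Bit x (A + y * V + st n y)) ∧
  (∀ p < P, ∀ n < N, ∀ n' < N, isW n → isW n' → cl p n = cl p n' →
    ∀ y < V, own (y + 1) = own y + p + 1 → st n y = st n' y) ∧
  tableSize P V N isW cl ≤ b.eval (matrixSize x P V A)

/-- The size bound on models speaks of cardinalities. Numbering the elements turns these into sums
of indicators, which a counting expression can evaluate. -/
theorem sum_ind_eq_card {N : ℕ} {Q : ℕ → Prop} {T : Type} {f : T → ℕ} (hf : Injective f)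
    (hr : ∀ n, (∃ t, f t = n) ↔ n < N ∧ Q n) :
    ∑ n ∈ Finset.range N, ind (Q n) = Nat.card T := by
  classical
  have h : ∀ n, ind (Q n) = if Q n then 1 else 0 := fun n => by unfold ind; congr
  simp only [h]
  rw [← Finset.card_filter, ← Nat.card_range_of_injective hf]
  refine (Nat.subtype_card _ fun n => ?_).symm
  rw [Finset.mem_filter, Finset.mem_range]
  exact (hr n).symm

theorem sum_sum_ind_eq_card {N N' : ℕ} {Q : ℕ → ℕ → Prop} {T : Type} {f : T → ℕ × ℕ}
    (hf : Injective f) (hr : ∀ n n', (∃ t, f t = (n, n')) ↔ n < N ∧ n' < N' ∧ Q n n') :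
    ∑ n ∈ Finset.range N, ∑ n' ∈ Finset.range N', ind (Q n n') = Nat.card T := by
  classical
  have h : ∀ n n', ind (Q n n') = if Q n n' then 1 else 0 := fun n n' => by unfold ind; congr
  simp only [h]
  rw [← Finset.sum_product' _ _ fun n n' => if Q n n' then 1 else 0, ← Finset.card_filter,
    ← Nat.card_range_of_injective hf]
  refine (Nat.subtype_card _ fun n => ?_).symm
  rw [Finset.mem_filter, Finset.mem_product, Finset.mem_range, Finset.mem_range, and_assoc]
  exact (hr n.1 n.2).symm

theorem Describes.bit_iff (h : Describes x G obj spec A own pos) (y z : Fin V) :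
    Bit x (A + y * V + z) ↔ (y, z) ∈ G.edges := by
  simpa using (getElem?_eq_some_decide.1 (h.edges y z)).2

/-- The code of the owner `p` has length `p + 1`, so the gap between consecutive positions reveals
the owner and no separate table of owners is needed. -/
theorem Describes.own_succ_iff (h : Describes x G obj spec A own pos) (y : Fin V) (p : Fin P) :
    own (y + 1) = own y + p + 1 ↔ G.owner y = p := by
  rw [h.own_succ, Fin.ext_iff]; omega

theorem Describes.matrixSize_eq (h : Describes x G obj spec A own pos) :
    matrixSize x P V A = G.size := by
  rw [matrixSize, GameArena.size, Fintype.card_fin, Fintype.card_fin,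
    sum_sum_ind_eq_card (T := G.edges) (f := fun e => (e.1.1.val, e.1.2.val)),
    Nat.card_eq_fintype_card, Fintype.card_coe]
  · rintro ⟨⟨a, b⟩, h⟩ ⟨⟨a', b'⟩, h'⟩ hab
    simp only [Prod.mk.injEq] at hab
    obtain ⟨h₁, h₂⟩ := hab
    obtain rfl := Fin.ext h₁
    obtain rfl := Fin.ext h₂
    rfl
  · intro n n'
    constructor
    · rintro ⟨⟨⟨a, b⟩, h'⟩, hab⟩
      simp only [Prod.mk.injEq] at hab
      obtain ⟨rfl, rfl⟩ := hab
      exact ⟨a.2, b.2, (h.bit_iff a b).2 h'⟩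
    · rintro ⟨hn, hn', hb⟩
      exact ⟨⟨(⟨n, hn⟩, ⟨n', hn'⟩), (h.bit_iff ⟨n, hn⟩ ⟨n', hn'⟩).1 hb⟩, rfl⟩

theorem Represents.tableSize_eq (h : Represents M N isW st cl e) :
    tableSize P V N isW cl = M.size := by
  rw [tableSize, EpistemicModel.size, sum_ind_eq_card h.injective h.range_iff, Nat.card_fin,
    Finset.sum_range]
  congr 2
  refine Finset.sum_congr rfl fun p _ => ?_
  refine sum_sum_ind_eq_card (f := fun t => (e t.1.1, e t.1.2)) ?_ fun n n' => ?_
  · rintro ⟨⟨a, b⟩, h₁⟩ ⟨⟨a', b'⟩, h₂⟩ hab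
    simp only [Prod.mk.injEq] at hab
    obtain rfl := h.injective hab.1
    obtain rfl := h.injective hab.2
    rfl
  · constructor
    · rintro ⟨⟨⟨a, b⟩, hr⟩, hab⟩
      simp only [Prod.mk.injEq] at hab
      obtain ⟨rfl, rfl⟩ := hab
      have ha := (h.range_iff _).1 ⟨a, rfl⟩
      have hb := (h.range_iff _).1 ⟨b, rfl⟩
      exact ⟨ha.1, hb.1, ha.2, hb.2, (h.rel p a b).2 hr⟩
    · rintro ⟨hn, hn', hw, hw', hc⟩
      obtain ⟨a, rfl⟩ := (h.range_iff _).2 ⟨hn, hw⟩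
      obtain ⟨b, rfl⟩ := (h.range_iff _).2 ⟨hn', hw'⟩
      exact ⟨⟨(a, b), (h.rel p a b).1 hc⟩, rfl⟩

theorem Represents.validModel {b : Polynomial ℕ} (h : Represents M N isW st cl e)
    (hd : Describes x G obj spec A own pos) {own' : ℕ → ℕ} (hown : ∀ y ≤ V, own' y = own y)
    (hM : M.size ≤ b.eval G.size) : ValidModel b x P V A N own' isW st cl := by
  refine ⟨fun n hn hw y hy => ?_, fun p hp n hn n' hn' hw hw' hc y hy ho => ?_, ?_⟩
  · obtain ⟨w, rfl⟩ := (h.range_iff _).2 ⟨hn, hw⟩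
    have := h.strat w ⟨y, hy⟩
    simp only at this
    rw [this]
    exact ⟨Fin.is_lt _, (hd.bit_iff ⟨y, hy⟩ _).2 ((M.profile w _).2 ⟨⟨y, hy⟩, rfl⟩)⟩
  · obtain ⟨w, rfl⟩ := (h.range_iff _).2 ⟨hn, hw⟩
    obtain ⟨w', rfl⟩ := (h.range_iff _).2 ⟨hn', hw'⟩
    have h₁ := h.strat w ⟨y, hy⟩
    have h₂ := h.strat w' ⟨y, hy⟩
    simp only at h₁ h₂
    rw [h₁, h₂, GameArena.next, GameArena.next]
    rw [hown y hy.le, hown (y + 1) hy] at ho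
    have ho' := (hd.own_succ_iff ⟨y, hy⟩ ⟨p, hp⟩).1 ho
    have hs := M.strat_eq _ _ _ ((h.rel ⟨p, hp⟩ w w').1 hc)
    rw [← ho'] at hs
    simp only [EpistemicModel.profile, hs]
  · rwa [h.tableSize_eq, hd.matrixSize_eq]

/-- Equality of class labels is automatically an equivalence relation. Only the edges, the constancy
of strategies on classes and the size have to be checked. -/
theorem ValidModel.exists_represents {b : Polynomial ℕ}
    (hv : ValidModel b x P V A N own isW st cl) (hd : Describes x G obj spec A own pos) :
    ∃ M : EpistemicModel G {n // n < N ∧ isW n},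
      Represents M N isW st cl Subtype.val ∧ M.size ≤ b.eval G.size := by
  obtain ⟨h₁, h₂, h₃⟩ := hv
  let M : EpistemicModel G {n // n < N ∧ isW n} :=
    { rel := fun p n n' => cl p n = cl p n'
      equiv := fun p => ⟨fun _ => rfl, Eq.symm, Eq.trans⟩
      strat := fun p n => ⟨fun y => ⟨st n y.1, (h₁ n n.2.1 n.2.2 y.1 y.1.2).1⟩,
        fun y => (hd.bit_iff _ _).1 (h₁ n n.2.1 n.2.2 y.1 y.1.2).2⟩
      strat_eq := fun p n n' hr => Subtype.ext <| funext fun y => Fin.ext <|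
        h₂ p p.2 n n.2.1 n' n'.2.1 n.2.2 n'.2.2 hr y.1 y.1.2
          ((hd.own_succ_iff y.1 p).2 y.2) }
  have hM : Represents M N isW st cl Subtype.val :=
    ⟨Subtype.val_injective, fun n => ⟨fun ⟨w, h⟩ => h ▸ w.2, fun h => ⟨⟨n, h⟩, rfl⟩⟩,
      fun _ _ => rfl, fun _ _ _ => Iff.rfl⟩
  exact ⟨M, hM, by rwa [← hM.tableSize_eq, ← hd.matrixSize_eq]⟩

/-- The vertex `y` is visited between the times `V` and `2 * V` on the path `f`. -/
def Recurs (V : ℕ) (f : ℕ → ℕ) (y : ℕ) : Prop := ∃ i < 2 * V + 1, V ≤ i ∧ f i = y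

theorem recurs_iff {f : ℕ → ℕ} {s : G.PosProfile}
    (hf : ∀ i < 2 * V + 1, f i = G.outcome s i) (y : Fin V) :
    Recurs V f y ↔ y ∈ GameArena.inf (G.outcome s) := by
  rw [GameArena.mem_inf_outcome, Fintype.card_fin, Recurs]
  refine exists_congr fun i => and_congr_right fun hi => ?_
  rw [hf i hi, Fin.ext_iff]

/-- Local conditions for a certificate: `dev` is a deviation of the player `p`, `f₀ n` and `f₁ n`
are the outcomes in the world `n` without and with the deviation, `tr₀ n` and `tr₁ n` the truth
values of the formulas under these outcomes; and either the deviation shows that `p` is not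
rational in `n₀`, or the specification holds in all worlds. -/
def Certificate (x : List Bool) (V i₀ A N : ℕ) (own fin : ℕ → ℕ) (isW : ℕ → Prop)
    (st : ℕ → ℕ → ℕ) (p posP posSpec n₀ : ℕ) (clp dev : ℕ → ℕ) (f₀ f₁ : ℕ → ℕ → ℕ)
    (tr₀ tr₁ : ℕ → ℕ → Prop) : Prop :=
  (∀ y < V, dev y < V ∧ Bit x (A + y * V + dev y)) ∧
  (∀ n < N, isW n →
    f₀ n 0 = i₀ ∧ (∀ i < 2 * V, f₀ n (i + 1) = st n (f₀ n i)) ∧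
    f₁ n 0 = i₀ ∧ (∀ i < 2 * V,
      (own (f₁ n i + 1) = own (f₁ n i) + p + 1 → f₁ n (i + 1) = dev (f₁ n i)) ∧
      (¬own (f₁ n i + 1) = own (f₁ n i) + p + 1 → f₁ n (i + 1) = st n (f₁ n i))) ∧
    TruthTable x fin (fun y => Recurs V (f₀ n) y) (fun a => tr₀ n a) ∧
    TruthTable x fin (fun y => Recurs V (f₁ n) y) (fun a => tr₁ n a)) ∧
  ((isW n₀ ∧ (∀ n < N, isW n → clp n₀ = clp n → tr₀ n posP → tr₁ n posP) ∧
    ∃ n < N, isW n ∧ clp n₀ = clp n ∧ ¬tr₀ n posP ∧ tr₁ n posP) ∨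
   ∀ n < N, isW n → tr₀ n posSpec)

variable {fin : ℕ → ℕ}

theorem outcome_mem_muller {s : G.PosProfile} {φ : BoolFormula (Fin V)} :
    G.outcome s ∈ G.muller φ ↔ φ.Holds fun y => y ∈ GameArena.inf (G.outcome s) :=
  and_iff_right (G.outcome_mem_plays s)

theorem truth_iff_mem_muller (hF : FormulaTable x V fin) {f : ℕ → ℕ} {s : G.PosProfile}
    (hf : ∀ i < 2 * V + 1, f i = G.outcome s i) {tr : ℕ → Prop}
    (ht : TruthTable x fin (fun y => Recurs V f y) tr) {φ : BoolFormula (Fin V)} {a e : ℕ}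
    (ha : fin a ≠ 0) (hφ : Seg x a φ.encode e) : tr a ↔ G.outcome s ∈ G.muller φ := by
  rw [ht.holds_iff hF ha hφ, outcome_mem_muller]
  simp only [recurs_iff hf]

theorem path_eq_outcome {f : ℕ → ℕ} {s : G.PosProfile} {n : ℕ} (h₀ : f 0 = G.init)
    (h : ∀ i < n, ∀ y : Fin V, f i = y → f (i + 1) = G.next s y) :
    ∀ i < n + 1, f i = G.outcome s i := by
  intro i
  induction i with
  | zero => exact fun _ => h₀
  | succ i ih => exact fun hi => h i (by omega) _ (ih (by omega))

/-- The path tables are forced step by step to be the outcomes, and the truth tables are then forced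
to be the winning conditions. The deviation is read only at vertices of `p`; its other entries play
no role. -/
theorem Certificate.sound (hr : Represents M N isW st cl e)
    (hd : Describes x G obj spec A own pos) (hF : FormulaTable x V fin) {p : Fin P} {n₀ : ℕ}
    (hn₀ : n₀ < N) (hp : fin (pos p) ≠ 0) (hs : fin (pos P) ≠ 0)
    {dev : ℕ → ℕ} {f₀ f₁ : ℕ → ℕ → ℕ} {tr₀ tr₁ : ℕ → ℕ → Prop}
    (hc : Certificate x V G.init A N own fin isW st p (pos p) (pos P) n₀ (cl p) dev f₀ f₁ tr₀ tr₁) :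
    (∃ w p, w ∉ M.rationalFor (fun p => G.muller (obj p)) p) ∨
      ∀ w, G.outcome (M.profile w) ∈ G.muller spec := by
  obtain ⟨hdev, htab, hver⟩ := hc
  let t : G.PosStrategy p := ⟨fun y => ⟨dev y.1, (hdev y.1 y.1.2).1⟩,
    fun y => (hd.bit_iff _ _).1 (hdev y.1 y.1.2).2⟩
  have htab' := fun w => htab (e w) ((hr.range_iff _).1 ⟨w, rfl⟩).1 ((hr.range_iff _).1 ⟨w, rfl⟩).2
  have hf₀ : ∀ w, ∀ i < 2 * V + 1, f₀ (e w) i = G.outcome (M.profile w) i := fun w =>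
    path_eq_outcome (htab' w).1 fun i hi y hy => by
      rw [(htab' w).2.1 i hi, hy, hr.strat]
  have hf₁ : ∀ w, ∀ i < 2 * V + 1,
      f₁ (e w) i = G.outcome (G.deviate (M.profile w) p t) i := fun w =>
    path_eq_outcome (htab' w).2.2.1 fun i hi y hy => by
      have := (htab' w).2.2.2.1 i hi
      rw [hy, hd.own_succ_iff] at this
      rw [G.next_deviate]
      split_ifs with ho
      · exact this.1 ho
      · rw [this.2 ho, hr.strat]
  have hwin₀ := fun w => truth_iff_mem_muller hF (hf₀ w) (htab' w).2.2.2.2.1 hp (hd.seg_objective p)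
  have hwin₁ := fun w => truth_iff_mem_muller hF (hf₁ w) (htab' w).2.2.2.2.2 hp (hd.seg_objective p)
  rcases hver with ⟨hw₀, h₁, n, hn, hw, hc, h₂, h₃⟩ | hver
  · obtain ⟨w₀, rfl⟩ := (hr.range_iff _).2 ⟨hn₀, hw₀⟩
    obtain ⟨w, rfl⟩ := (hr.range_iff _).2 ⟨hn, hw⟩
    refine Or.inl ⟨w₀, p, fun h => h ⟨t, fun w' hrel hwin => ?_, w, (hr.rel _ _ _).1 hc,
      fun h' => h₂ ((hwin₀ w).2 h'), (hwin₁ w).1 h₃⟩⟩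
    have hw' := (hr.range_iff _).1 ⟨w', rfl⟩
    exact (hwin₁ w').1 (h₁ _ hw'.1 hw'.2 ((hr.rel _ _ _).2 hrel) ((hwin₀ w').2 hwin))
  · refine Or.inr fun w => ?_
    have hw := (hr.range_iff _).1 ⟨w, rfl⟩
    exact (truth_iff_mem_muller hF (hf₀ w) (htab' w).2.2.2.2.1 hs hd.seg_spec).1 (hver _ hw.1 hw.2)

/-- The meaning of the tables of a certificate, for the deviation `t` of `p`. -/
structure CertificateTables (M : EpistemicModel G W) (x : List Bool) (e : W → ℕ)
    {p : Fin P} (t : G.PosStrategy p) (dev : ℕ → ℕ) (f₀ f₁ : ℕ → ℕ → ℕ)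
    (tr₀ tr₁ : ℕ → ℕ → Prop) : Prop where
  dev : ∀ y : Fin V, ∃ z : Fin V, dev y = z ∧ (y, z) ∈ G.edges ∧
    ∀ h : G.owner y = p, z = t.1 ⟨y, h⟩
  path : ∀ w, ∀ i < 2 * V + 1, f₀ (e w) i = G.outcome (M.profile w) i
  path_dev : ∀ w, ∀ i < 2 * V + 1, f₁ (e w) i = G.outcome (G.deviate (M.profile w) p t) i
  truth : ∀ w, ∀ a < x.length, ∀ (φ : BoolFormula (Fin V)) (c : ℕ), Seg x a φ.encode c →
    (tr₀ (e w) a ↔ G.outcome (M.profile w) ∈ G.muller φ)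
  truth_dev : ∀ w, ∀ a < x.length, ∀ (φ : BoolFormula (Fin V)) (c : ℕ), Seg x a φ.encode c →
    (tr₁ (e w) a ↔ G.outcome (G.deviate (M.profile w) p t) ∈ G.muller φ)

theorem CertificateTables.certificate {p : Fin P} {t : G.PosStrategy p} {dev : ℕ → ℕ}
    {f₀ f₁ : ℕ → ℕ → ℕ} {tr₀ tr₁ : ℕ → ℕ → Prop} {n₀ : ℕ} {own' : ℕ → ℕ}
    (h : CertificateTables M x e t dev f₀ f₁ tr₀ tr₁) (hr : Represents M N isW st cl e)
    (hd : Describes x G obj spec A own pos) (hfin : IsFormulaEnd x V fin)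
    (hown : ∀ y ≤ V, own' y = own y)
    (hver : (∃ w₀, e w₀ = n₀ ∧ (∀ w', M.rel p w₀ w' →
        G.outcome (M.profile w') ∈ G.muller (obj p) →
        G.outcome (G.deviate (M.profile w') p t) ∈ G.muller (obj p)) ∧
      ∃ w', M.rel p w₀ w' ∧ G.outcome (M.profile w') ∉ G.muller (obj p) ∧
        G.outcome (G.deviate (M.profile w') p t) ∈ G.muller (obj p)) ∨
      ∀ w, G.outcome (M.profile w) ∈ G.muller spec) :
    Certificate x V G.init A N own' fin isW st p (pos p) (pos P) n₀ (cl p) dev f₀ f₁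
      tr₀ tr₁ := by
  refine ⟨fun y hy => ?_, fun n hn hw => ?_, ?_⟩
  · obtain ⟨z, hz, hE, -⟩ := h.dev ⟨y, hy⟩
    simp only at hz
    rw [hz]
    exact ⟨z.2, (hd.bit_iff ⟨y, hy⟩ z).2 hE⟩
  · obtain ⟨w, rfl⟩ := (hr.range_iff _).2 ⟨hn, hw⟩
    refine ⟨h.path w 0 (by omega), fun i hi => ?_, h.path_dev w 0 (by omega),
      fun i hi => ?_, hfin.truthTable fun a ha φ c hφ => ?_, hfin.truthTable fun a ha φ c hφ => ?_⟩
    · rw [h.path w i (by omega), h.path w (i + 1) (by omega), hr.strat]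
      rfl
    · rw [h.path_dev w i (by omega), h.path_dev w (i + 1) (by omega)]
      set y := G.outcome (G.deviate (M.profile w) p t) i with hy
      rw [hown y y.2.le, hown (y + 1) y.2, hd.own_succ_iff]
      have hstep : G.outcome (G.deviate (M.profile w) p t) (i + 1)
          = G.next (G.deviate (M.profile w) p t) y := rfl
      rw [hstep, G.next_deviate]
      obtain ⟨z, hz, -, ho⟩ := h.dev y
      refine ⟨fun ho' => ?_, fun ho' => ?_⟩
      · rw [dif_pos ho', hz, ho ho']
      · rw [dif_neg ho', hr.strat]
    · rw [h.truth w a ha φ c hφ, outcome_mem_muller]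
      simp only [recurs_iff (h.path w)]
    · rw [h.truth_dev w a ha φ c hφ, outcome_mem_muller]
      simp only [recurs_iff (h.path_dev w)]
  · have hp := fun w => h.truth w (pos p) (hd.pos_le p.2.le) _ _ (hd.seg_objective p)
    have hp' := fun w => h.truth_dev w (pos p) (hd.pos_le p.2.le) _ _ (hd.seg_objective p)
    rcases hver with ⟨w₀, rfl, h₁, w', hrel, h₂, h₃⟩ | hver
    · refine Or.inl ⟨((hr.range_iff _).1 ⟨w₀, rfl⟩).2, fun n hn hw hc => ?_, e w',
        ((hr.range_iff _).1 ⟨w', rfl⟩).1, ((hr.range_iff _).1 ⟨w', rfl⟩).2,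
        (hr.rel _ _ _).2 hrel, fun h' => h₂ ((hp w').1 h'), (hp' w').2 h₃⟩
      obtain ⟨w, rfl⟩ := (hr.range_iff _).2 ⟨hn, hw⟩
      rw [hp, hp']
      exact h₁ w ((hr.rel _ _ _).1 hc)
    · refine Or.inr fun n hn hw => ?_
      obtain ⟨w, rfl⟩ := (hr.range_iff _).2 ⟨hn, hw⟩
      exact (h.truth w _ (hd.pos_le le_rfl) _ _ hd.seg_spec).2 (hver w)

end Models

end Complexity

namespace Complexity

open Function

/-! ### The verifier -/

section Definable

set_option synthInstance.maxHeartbeats 400000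
set_option synthInstance.maxSize 5000
set_option maxHeartbeats 1000000

variable {X u v : Store → List Bool} {f g P V i₀ A M n : Store → ℕ}

instance [Tm f] [Tm g] : Df (fun c => f c ≠ g c) :=
  .congr (P := fun c => ¬f c = g c) inferInstance fun _ => Iff.rfl

instance [Wd X] [Tm f] [Tm g] : Df (fun c => Idx (X c) (f c) (g c)) := by
  unfold Idx; infer_instance

instance [Wd X] [Wd v] [Tm V] [Tm M] :
    Df (fun c => FormulaTable (X c) (V c) fun a => table (v c) (M c) 2 a 0) := by
  unfold FormulaTable; beta_reduce; infer_instance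

instance [Wd X] [Wd v] [Tm P] [Tm V] [Tm i₀] [Tm A] [Tm M] :
    Df (fun c => Header (X c) (P c) (V c) (i₀ c) (A c) (fun y => table (v c) (M c) 0 y 0)
      (fun p => table (v c) (M c) 1 p 0) (fun a => table (v c) (M c) 2 a 0)) := by
  unfold Header; beta_reduce; infer_instance

instance (t : ℕ) [Wd v] [Tm V] [Tm M] [Tm n] [Tm f] :
    Df (fun c => Recurs (V c) (fun i => table (v c) (M c) t (n c) i) (f c)) := by
  unfold Recurs; beta_reduce; infer_instance

instance (t t' : ℕ) [Wd X] [Wd v] [Tm V] [Tm M] [Tm n] :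
    Df (fun c => TruthTable (X c) (fun a => table (v c) (M c) 2 a 0)
      (fun y => Recurs (V c) (fun i => table (v c) (M c) t (n c) i) y)
      (fun a => 0 < table (v c) (M c) t' (n c) a)) := by
  unfold TruthTable; beta_reduce; infer_instance

instance (b : Polynomial ℕ) [Wd X] [Wd u] [Wd v] [Tm P] [Tm V] [Tm A] [Tm M] :
    Df (fun c => ValidModel b (X c) (P c) (V c) (A c) (M c) (fun y => table (v c) (M c) 0 y 0)
      (fun n => 0 < table (u c) (M c) 0 n 0) (fun n y => table (u c) (M c) 1 n y)
      (fun p n => table (u c) (M c) 2 p n)) := by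
  unfold ValidModel tableSize matrixSize; beta_reduce; infer_instance

/-- A certificate whose tables are written in the word `v`, for the model in the word `u`. -/
def CertificateWord (x u v : List Bool) (P V i₀ A M : ℕ) : Prop :=
  ∃ p < P, ∃ n₀ < M, Certificate x V i₀ A M (fun y => table v M 0 y 0) (fun a => table v M 2 a 0)
    (fun n => 0 < table u M 0 n 0) (fun n y => table u M 1 n y) p (table v M 1 p 0)
    (table v M 1 P 0) n₀ (fun n => table u M 2 p n) (fun y => table v M 3 y 0)
    (fun n i => table v M 4 n i) (fun n i => table v M 5 n i)
    (fun n a => 0 < table v M 6 n a) (fun n a => 0 < table v M 7 n a)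

instance [Wd X] [Wd u] [Wd v] [Tm P] [Tm V] [Tm i₀] [Tm A] [Tm M] :
    Df (fun c => CertificateWord (X c) (u c) (v c) (P c) (V c) (i₀ c) (A c) (M c)) := by
  unfold CertificateWord Certificate; beta_reduce; infer_instance

/-- A bound for all numbers in the tables. -/
def tableBound (b : Polynomial ℕ) (x : List Bool) : ℕ := b.eval x.length + 2 * x.length + 8

/-- The verifier: `v` contains a parsing table of `x`, and a certificate for the model in the word
`u` if there is such a model. -/
def Accepts (b : Polynomial ℕ) (x u v : List Bool) : Prop :=
  let M := tableBound b x
  ∃ P < M, ∃ V < M, ∃ A < M, ∃ i₀ < M,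
    Header x P V i₀ A (fun y => table v M 0 y 0) (fun p => table v M 1 p 0)
      (fun a => table v M 2 a 0) ∧
    (ValidModel b x P V A M (fun y => table v M 0 y 0) (fun n => 0 < table u M 0 n 0)
      (fun n y => table u M 1 n y) (fun p n => table u M 2 p n) →
      CertificateWord x u v P V i₀ A M)

instance (b : Polynomial ℕ) [Wd X] [Wd u] [Wd v] : Df (fun c => Accepts b (X c) (u c) (v c)) := by
  unfold Accepts tableBound; infer_instance

end Definable

end Complexity

namespace Complexity

open Function

/-! ### Completeness and soundness of the verifier. -/

section Verification

variable {x : List Bool} {P V K : ℕ} {G : GameArena (Fin P) (Fin V)}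
  {obj : Fin P → BoolFormula (Fin V)} {spec : BoolFormula (Fin V)} {A : ℕ} {own pos fin : ℕ → ℕ}
  {W : Type} {M : EpistemicModel G W} {isW : ℕ → Prop} {st cl : ℕ → ℕ → ℕ} {e : W → ℕ}

/-- Players and vertices are counted in unary at the start of `x`, and the matrix spends one bit on
each pair of vertices. Hence the size of the arena is at most the length of the word. -/
theorem Describes.size_le (h : Describes x G obj spec A own pos) :
    P < x.length ∧ V < x.length ∧ A < x.length ∧ G.size ≤ x.length := by
  have hown : ∀ y ≤ V, P + V + 2 ≤ own y := by
    intro y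
    induction y with
    | zero => intro _; rw [h.own_zero]; omega
    | succ y ih =>
      intro hy
      have h₁ := h.own_succ ⟨y, hy⟩
      have h₂ := ih (by omega)
      simp only at h₁
      omega
  have h₁ := hown V le_rfl
  have h₂ := h.matrix
  have h₃ := h.pos_zero
  have h₄ := h.pos_le (Nat.zero_le P)
  have h₅ : G.edges.card ≤ V * V := by
    refine (Finset.card_le_univ _).trans ?_
    simp
  refine ⟨by omega, by omega, by omega, ?_⟩
  rw [GameArena.size, Fintype.card_fin, Fintype.card_fin]
  omega

theorem ValidModel.congr_own {b : Polynomial ℕ} {own' : ℕ → ℕ}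
    (h : ValidModel b x P V A K own' isW st cl) (hown : ∀ y ≤ V, own' y = own y) :
    ValidModel b x P V A K own isW st cl :=
  ⟨h.1, fun p hp n hn n' hn' hw hw' hc y hy ho => h.2.1 p hp n hn n' hn' hw hw' hc y hy <| by
    rwa [hown y hy.le, hown (y + 1) hy], h.2.2⟩

theorem ind_le_one (Q : Prop) : ind Q ≤ 1 := by
  unfold ind; split_ifs <;> omega

theorem IsFormulaEnd.congr (h : IsFormulaEnd x V fin) {fin' : ℕ → ℕ}
    (hf : ∀ a < x.length, fin' a = fin a) : IsFormulaEnd x V fin' := fun a ha => by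
  rw [hf a ha]; exact h a ha

theorem extend_zero_le (e : W → ℕ) {f : W → ℕ} (hf : ∀ w, f w ≤ K) (n : ℕ) :
    Function.extend e f 0 n ≤ K := by
  classical
  rw [Function.extend_def]
  split_ifs
  · exact hf _
  · exact Nat.zero_le _

/-- The deviation `t` of a player, together with all outcomes and all truth values, forms a
certificate. -/
theorem exists_certificateTables (hr : Represents M K isW st cl e) (hV : V < x.length)
    (hK : 2 * x.length < K) {p : Fin P} (t : G.PosStrategy p) :
    ∃ g : ℕ → ℕ → ℕ → ℕ, (∀ i a b, g i a b ≤ K) ∧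
      ∀ (dev : ℕ → ℕ) (f₀ f₁ tr₀ tr₁ : ℕ → ℕ → ℕ), (∀ a < K, dev a = g 3 a 0) →
        (∀ a < K, ∀ b < K, f₀ a b = g 4 a b ∧ f₁ a b = g 5 a b ∧ tr₀ a b = g 6 a b ∧
          tr₁ a b = g 7 a b) →
        CertificateTables M x e t dev f₀ f₁ (fun n a => 0 < tr₀ n a) (fun n a => 0 < tr₁ n a) := by
  classical
  choose next hnext using G.total
  let dev : Fin V → Fin V := fun y => if h : G.owner y = p then t.1 ⟨y, h⟩ else next y
  -- Worlds are addressed by their numbers; numbers that belong to no world get the value `0`, which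
  -- is never consulted.
  let path : ℕ → (W → G.PosProfile) → ℕ → ℕ := fun i s =>
    Function.extend e (fun w => (G.outcome (s w) i).val) 0
  let truth : ℕ → (W → G.PosProfile) → ℕ → ℕ := fun a s => Function.extend e (fun w =>
    ind (∃ (φ : BoolFormula (Fin V)) (c : ℕ), Seg x a φ.encode c ∧ G.outcome (s w) ∈ G.muller φ)) 0
  have htruth : ∀ a s w (φ : BoolFormula (Fin V)) (c : ℕ), Seg x a φ.encode c →
      (0 < truth a s (e w) ↔ G.outcome (s w) ∈ G.muller φ) := by
    intro a s w φ c hφ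
    simp only [truth]
    rw [hr.injective.extend_apply, ind_pos]
    refine ⟨?_, fun h => ⟨φ, c, hφ, h⟩⟩
    rintro ⟨ψ, c', hψ, h⟩
    -- The formula at a position is unique, so the existential in `truth` refers to this very
    -- formula.
    rwa [(seg_encode_unique hφ hψ).1]
  have hpath : ∀ i s w, path i s (e w) = (G.outcome (s w) i).val := fun i s w =>
    hr.injective.extend_apply _ _ _
  refine ⟨fun i a b => match i with
    | 3 => if h : a < V then (dev ⟨a, h⟩).val else 0
    | 4 => path b M.profile a
    | 5 => path b (fun w => G.deviate (M.profile w) p t) a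
    | 6 => truth b M.profile a
    | 7 => truth b (fun w => G.deviate (M.profile w) p t) a
    | _ => 0, fun i a b => ?_, ?_⟩
  · have h₁ : ∀ s, path b s a ≤ K := fun s => extend_zero_le e (fun w => by omega) a
    have h₂ : ∀ s, truth b s a ≤ K := fun s =>
      extend_zero_le e (fun w => (ind_le_one _).trans (by omega)) a
    dsimp only
    split
    · split_ifs with h
      · have := (dev ⟨a, h⟩).2; omega
      · exact Nat.zero_le _
    · exact h₁ _
    · exact h₁ _
    · exact h₂ _
    · exact h₂ _
    · exact Nat.zero_le _
  · intro dev' f₀ f₁ tr₀ tr₁ hdev htab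
    have he : ∀ w, e w < K := fun w => ((hr.range_iff _).1 ⟨w, rfl⟩).1
    refine ⟨fun y => ⟨dev y, ?_, ?_, fun h => dif_pos h⟩, fun w i hi => ?_, fun w i hi => ?_,
      fun w a ha φ c hφ => ?_, fun w a ha φ c hφ => ?_⟩
    · rw [hdev y (by omega)]; exact dif_pos y.2
    · simp only [dev]
      split_ifs with h
      · exact t.2 ⟨y, h⟩
      · exact hnext y
    · rw [(htab _ (he w) i (by omega)).1]; exact hpath _ _ _
    · rw [(htab _ (he w) i (by omega)).2.1]
      exact hpath i (fun w => G.deviate (M.profile w) p t) w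
    · rw [(htab _ (he w) a (by omega)).2.2.1]; exact htruth _ _ _ φ c hφ
    · rw [(htab _ (he w) a (by omega)).2.2.2]
      exact htruth a (fun w => G.deviate (M.profile w) p t) w φ c hφ

/-- If `u` describes a valid model, either everybody is rational everywhere and the hypothesis
yields the specification, or some world, player and deviation show the contrary. Both cases have a
certificate. For any other `u` the parse alone suffices. -/
theorem Describes.exists_accepts (hd : Describes x G obj spec A own pos) (b : Polynomial ℕ)
    (h : ∀ (W : Type) (_ : Finite W) (M : EpistemicModel G W), M.size ≤ b.eval G.size →
      (∀ w p, w ∈ M.rationalFor (fun p => G.muller (obj p)) p) →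
      ∀ w, G.outcome (M.profile w) ∈ G.muller spec) (u : List Bool) :
    ∃ v, v.length = tableBound b x ^ 4 ∧ Accepts b x u v := by
  set K := tableBound b x with hK
  -- The 8 leaves room for the table numbers 0 to 7, and twice the length of `x` for the times up to
  -- `2 * V`.
  have hK' : 2 * x.length + 8 ≤ K := by rw [hK, tableBound]; omega
  obtain ⟨hPx, hVx, hAx, -⟩ := hd.size_le
  obtain ⟨fin, hfin_le, hfin⟩ := exists_isFormulaEnd x V
  -- The certificate tables are chosen from `u` before `v` exists, so the claim is stated for every
  -- `v` that will agree with them and carry a correct parse.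
  have hcert : ∃ g : ℕ → ℕ → ℕ → ℕ, (∀ i a b, g i a b ≤ K) ∧ ∀ v : List Bool,
      (∀ i < 8, 3 ≤ i → ∀ a < K, ∀ b < K, table v K i a b = g i a b) →
      (∀ y ≤ V, table v K 0 y 0 = own y) → (∀ p ≤ P, table v K 1 p 0 = pos p) →
      (IsFormulaEnd x V fun a => table v K 2 a 0) →
      ValidModel b x P V A K (fun y => table v K 0 y 0) (fun n => 0 < table u K 0 n 0)
        (fun n y => table u K 1 n y) (fun p n => table u K 2 p n) →
      CertificateWord x u v P V G.init A K := by
    by_cases hv : ValidModel b x P V A K own (fun n => 0 < table u K 0 n 0)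
        (fun n y => table u K 1 n y) (fun p n => table u K 2 p n)
    · obtain ⟨M, hr, hM⟩ := hv.exists_represents hd
      have hver : ∃ (p : Fin P) (n₀ : ℕ) (t : G.PosStrategy p), n₀ < K ∧
          ((∃ w₀, Subtype.val w₀ = n₀ ∧
          (∀ w', M.rel p w₀ w' → G.outcome (M.profile w') ∈ G.muller (obj p) →
            G.outcome (G.deviate (M.profile w') p t) ∈ G.muller (obj p)) ∧
          ∃ w', M.rel p w₀ w' ∧ G.outcome (M.profile w') ∉ G.muller (obj p) ∧
            G.outcome (G.deviate (M.profile w') p t) ∈ G.muller (obj p)) ∨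
          ∀ w, G.outcome (M.profile w) ∈ G.muller spec) := by
        by_cases hrat : ∀ w p, w ∈ M.rationalFor (fun p => G.muller (obj p)) p
        · have hfinite : Finite {n // n < K ∧ 0 < table u K 0 n 0} :=
            ((Set.finite_lt_nat K).subset fun n hn => hn.1).to_subtype
          choose next hnext using G.total
          -- If the specification holds everywhere, the player, the number `0` and the deviation are
          -- mere fillers; `0` need not even be a world.
          exact ⟨G.owner G.init, 0, ⟨fun y => next y, fun y => hnext y⟩, by omega,
            Or.inr (h _ hfinite M hM hrat)⟩
        · push Not at hrat
          obtain ⟨w₀, p, hw₀⟩ := hrat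
          obtain ⟨t, ht⟩ := not_not.1 hw₀
          exact ⟨p, w₀, t, w₀.2.1, Or.inl ⟨w₀, rfl, ht⟩⟩
      obtain ⟨p, n₀, t, hn₀, hver⟩ := hver
      obtain ⟨g, hg, htab⟩ := exists_certificateTables hr hVx (by omega) t
      refine ⟨g, hg, fun v hg hown hpos hfin _ => ⟨p, p.2, n₀, hn₀, ?_⟩⟩
      rw [hpos p p.2.le, hpos P le_rfl]
      exact (htab _ _ _ _ _ (fun a ha => hg 3 (by omega) (by omega) a ha 0 (by omega))
        fun a ha b hb => ⟨hg 4 (by omega) (by omega) a ha b hb, hg 5 (by omega) (by omega) a ha b hb,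
          hg 6 (by omega) (by omega) a ha b hb,
          hg 7 (by omega) (by omega) a ha b hb⟩).certificate hr hd hfin hown hver
    · exact ⟨0, fun _ _ _ => Nat.zero_le _, fun v _ hown _ _ hv' => absurd (hv'.congr_own hown) hv⟩
  obtain ⟨g, hg, hcert⟩ := hcert
  -- At the indices that are read, `own` and `pos` are smaller than the length of `x`, so the
  -- truncation at `K` changes nothing there.
  obtain ⟨v, hv, htab⟩ := exists_table K fun i a b => match i with
    | 0 => min (own a) K
    | 1 => min (pos a) K
    | 2 => fin a
    | i + 3 => g (i + 3) a b
  refine ⟨v, hv, ?_⟩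
  have hown : ∀ y ≤ V, table v K 0 y 0 = own y := fun y hy => by
    have := hd.own_le hy
    rw [htab 0 (by omega) y (by omega) 0 (by omega) (min_le_right _ _)]
    exact min_eq_left (by omega)
  have hpos : ∀ p ≤ P, table v K 1 p 0 = pos p := fun p hp => by
    have := hd.pos_le hp
    rw [htab 1 (by omega) p (by omega) 0 (by omega) (min_le_right _ _)]
    exact min_eq_left (by omega)
  have hfin' : IsFormulaEnd x V fun a => table v K 2 a 0 := hfin.congr fun a ha =>
    htab 2 (by omega) a (by omega) 0 (by omega) ((hfin_le a).trans (by omega))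
  refine ⟨P, by omega, V, by omega, A, by omega, G.init, by have := G.init.2; omega,
    hd.header hown hpos hfin', hcert v (fun i hi hi' a ha b hb => ?_) hown hpos hfin'⟩
  obtain ⟨i, rfl⟩ := Nat.exists_eq_add_of_le' hi'
  exact htab (i + 3) (by omega) a ha b hb (hg _ _ _)

/-- Worlds are numbered arbitrarily, and the label of an information cell is the number of a chosen
representative, which is again below `K`. -/
theorem exists_represents [Finite W] (M : EpistemicModel G W)
    (hV : V < K) (hP : P < K) (hK : 8 ≤ K) (hW : Nat.card W < K) :
    ∃ (u : List Bool) (e : W → ℕ), u.length = K ^ 4 ∧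
      Represents M K (fun n => 0 < table u K 0 n 0) (fun n y => table u K 1 n y)
        (fun p n => table u K 2 p n) e := by
  classical
  let e : W → ℕ := fun w => (Finite.equivFin W w).val
  have he : Injective e := Fin.val_injective.comp (Finite.equivFin W).injective
  have heK : ∀ w, e w < K := fun w => (Finite.equivFin W w).2.trans hW
  let S : Fin P → Setoid W := fun p => ⟨M.rel p, M.equiv p⟩
  obtain ⟨u, hu, htab⟩ := exists_table K fun i a b => match i with
    | 0 => Function.extend e (fun _ => 1) 0 a
    | 1 => if h : b < V then
        Function.extend e (fun w => (G.next (M.profile w) ⟨b, h⟩).val) 0 a else 0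
    | 2 => if h : a < P then
        Function.extend e (fun w => e (Quotient.mk (S ⟨a, h⟩) w).out) 0 b else 0
    | _ => 0
  have h₀ : ∀ n < K, table u K 0 n 0 = Function.extend e (fun _ => 1) 0 n := fun n hn =>
    htab 0 (by omega) n hn 0 (by omega) (extend_zero_le e (fun _ => by omega) n)
  have h₁ : ∀ w (y : Fin V), table u K 1 (e w) y = G.next (M.profile w) y := fun w y => by
    have h : (if h : y.val < V then
        Function.extend e (fun w => (G.next (M.profile w) ⟨y, h⟩).val) 0 (e w)
        else 0) = (G.next (M.profile w) y).val := by
      rw [dif_pos y.2, he.extend_apply]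
    have h' := htab 1 (by omega) (e w) (heK w) y (by omega)
    simp only [h] at h'
    exact h' (by omega)
  have h₂ : ∀ (p : Fin P) w, table u K 2 p (e w) = e (Quotient.mk (S p) w).out := fun p w => by
    have h : (if h : p.val < P then
        Function.extend e (fun w => e (Quotient.mk (S ⟨p, h⟩) w).out) 0 (e w)
        else 0) = e (Quotient.mk (S p) w).out := by
      rw [dif_pos p.2, he.extend_apply]
    have h' := htab 2 (by omega) p (by omega) (e w) (heK w)
    simp only [h] at h'
    exact h' (heK _).le
  refine ⟨u, e, hu, he, fun n => ⟨?_, ?_⟩, h₁, fun p w w' => ?_⟩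
  · rintro ⟨w, rfl⟩
    refine ⟨heK w, ?_⟩
    rw [h₀ _ (heK w), he.extend_apply]
    exact Nat.one_pos
  · rintro ⟨hn, h⟩
    rw [h₀ n hn] at h
    by_contra hne
    rw [Function.extend_apply' _ _ _ hne] at h
    exact Nat.lt_irrefl _ h
  · rw [h₂, h₂, he.eq_iff, Quotient.out_inj, Quotient.eq]
    rfl

theorem Describes.congr_instance (hd : Describes x G obj spec A own pos) {P' V' A' : ℕ}
    {own' pos' : ℕ → ℕ} {G' : GameArena (Fin P') (Fin V')} {obj' : Fin P' → BoolFormula (Fin V')}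
    {spec' : BoolFormula (Fin V')} (hd' : Describes x G' obj' spec' A' own' pos') :
    P' = P ∧ V' = V ∧ G'.init.val = G.init.val ∧ Describes x G obj spec A' own' pos' := by
  cases encode_injective (hd'.encode_eq.trans hd.encode_eq.symm)
  exact ⟨rfl, rfl, rfl, hd'⟩

/-- The parse in `v` is a priori that of some other instance; by injectivity of the encoding it is
the given one. The tables in `u` then pass the validity test, which releases the certificate. -/
theorem Accepts.sound {b : Polynomial ℕ} {u v : List Bool} (h : Accepts b x u v)
    (hd : Describes x G obj spec A own pos)
    (hr : Represents M (tableBound b x) (fun n => 0 < table u (tableBound b x) 0 n 0)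
      (fun n y => table u (tableBound b x) 1 n y) (fun p n => table u (tableBound b x) 2 p n) e)
    (hM : M.size ≤ b.eval G.size) :
    (∃ w p, w ∉ M.rationalFor (fun p => G.muller (obj p)) p) ∨
      ∀ w, G.outcome (M.profile w) ∈ G.muller spec := by
  obtain ⟨P', -, V', -, A', -, i₀, -, hh, hc⟩ := h
  obtain ⟨G', obj', spec', hd', rfl⟩ := hh.exists_describes
  obtain ⟨rfl, rfl, hinit, hd'⟩ := hd.congr_instance hd'
  obtain ⟨p, hp, n₀, hn₀, hc⟩ := hc (hr.validModel hd' (fun _ _ => rfl) hM)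
  rw [hinit] at hc
  obtain ⟨-, -, -, -, -, -, -, -, -, hpos, hspec, -, -, hF⟩ := hh
  exact Certificate.sound (p := ⟨p, hp⟩) hr hd' hF hn₀ (hpos p hp).1 hspec hc

end Verification

/-- Words `u` of the given length reach a representation of every model that the size bound admits,
because the number of worlds is at most `b` of the length of `x`. Words that encode no instance are
rejected, since no `v` contains a parse of them. -/
theorem mem_VPCKRLanguage_iff (b : Polynomial ℕ) (x : List Bool) : x ∈ VPCKRLanguage b ↔
    ∀ u : List Bool, u.length ≤ tableBound b x ^ 4 →
      ∃ v : List Bool, v.length ≤ tableBound b x ^ 4 ∧ Accepts b x u v := by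
  constructor
  · rintro ⟨⟨P, V, G, obj, spec⟩, hI, hx⟩ u -
    obtain ⟨A, own, pos, hd⟩ := exists_describes hx
    obtain ⟨v, hv, h⟩ := hd.exists_accepts b (mem_VPCKR_iff.1 hI) u
    exact ⟨v, hv.le, h⟩
  · intro h
    -- Any `u` will do here: acceptance always includes a parse, so `x` encodes an instance.
    obtain ⟨v, -, P, -, V, -, A, -, i₀, -, hh, -⟩ := h [] (Nat.zero_le _)
    obtain ⟨G, obj, spec, hd, -⟩ := hh.exists_describes
    refine ⟨⟨P, V, G, obj, spec⟩, mem_VPCKR_iff.2 fun W _ M hM hrat => ?_, hd.encode_eq⟩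
    obtain ⟨hP, hV, -, hG⟩ := hd.size_le
    have hW : Nat.card W ≤ b.eval x.length := by
      refine le_trans ?_ (hM.trans (b.eval_le_eval_of_le hG))
      rw [EpistemicModel.size]
      omega
    have hK : tableBound b x = b.eval x.length + 2 * x.length + 8 := rfl
    obtain ⟨u, e, hu, hr⟩ := exists_represents (P := P) (V := V) (K := tableBound b x) M
      (by omega) (by omega) (by omega) (by omega)
    obtain ⟨v, -, h⟩ := h u hu.le
    rcases h.sound hd hr hM with ⟨w, p, hw⟩ | h
    · exact absurd (hrat w p) hw
    · exact h

end Complexity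

theorem mainTheorem3 (b : Polynomial ℕ) : Complexity.InPi2 (VPCKRLanguage b) := by
  obtain ⟨f, hf, hf_iff⟩ := Complexity.polyTime_of_df
    (P := fun c => Complexity.Accepts b (c 0) (c 1) (c 2)) inferInstance
  refine ⟨f, (b + 2 * Polynomial.X + 8) ^ 4, hf, fun x => ?_⟩
  have hq : ((b + 2 * Polynomial.X + 8) ^ 4).eval x.length = Complexity.tableBound b x ^ 4 := by
    simp [Complexity.tableBound]
  rw [Complexity.mem_VPCKRLanguage_iff, hq]
  simp only [hf_iff]
  rfl
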